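/- Let $\mathbb{T}^d=\mathbb{R}^d/\mathbb{Z}^d$, let $\mathcal{P}^1(\mathbb{T}^d)$ be the set of Borel probabilities on $\mathbb{T}^d$ with the Kantorovich–Rubinstein (1-Wasserstein) metric $W_1$, let $U$ be a compact metric space, and let $f:[0,T]\times\mathbb{T}^d\times\mathcal{P}^1(\mathbb{T}^d)\times U\to\mathbb{R}^d$ and $g:[0,T]\times\mathbb{T}^d\times\mathcal{P}^1(\mathbb{T}^d)\times U\to\mathbb{R}$ be continuous functions such that (a) there is $\alpha:\mathbb{R}\to[0,\infty)$ with $\alpha(\delta)\to0$ as $\delta\to0$ and $\|f(t',x,m,u)-f(t'',x,m,u)\|\le\alpha(t'-t'')$, $|g(t',x,m,u)-g(t'',x,m,u)|\le\alpha(t'-t'')$ for all $t',t''\in[0,T]$, $x,m,u$; (b) there is a constant $L$ with $\|f(t,x',m',u)-f(t,x'',m'',u)\|\le L(\|x'-x''\|+W_1(m',m''))$ and $|g(t,x',m',u)-g(t,x'',m'',u)|\le L(\|x'-x''\|+W_1(m',m''))$ for all $t\in[0,T]$, $x',x'',m',m'',u$. Put $F(t,x,m)=\mathrm{co}\{(f(t,x,m,u),g(t,x,m,u)):u\in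 U\}$. For $0\le s\le r\le T$ and a flow of probabilities $m(\cdot)$ on $[s,r]$ let $\mathrm{SOL}(r,s,m(\cdot))$ be the set of absolutely continuous $(x(\cdot),z(\cdot)):[s,r]\to\mathbb{T}^d\times\mathbb{R}$ with $(\dot x(t),\dot z(t))\in F(t,x(t),m(t))$ for a.e. $t\in[s,r]$. For $\psi\in C(\mathbb{T}^d)$ put $$(B^{s,r}_{m(\cdot)}\psi)(y)=\sup\{\psi(x(r))+z(r)-z(s):(x(\cdot),z(\cdot))\in\mathrm{SOL}(r,s,m(\cdot)),\ x(s)=y\}.$$ Let $\mathrm{p}:\mathbb{T}^d\times\mathbb{R}\to\mathbb{T}^d$ be the projection, and for a probability $\nu$ on $\mathbb{T}^d\times\mathbb{R}$ with a finite first moment let $[\phi,\nu]=\int(\phi(x)+z)\,\nu(d(x,z))$. A flow $\nu(\cdot)$ of such probabilities is a solution of the mean field type differential inclusion on $[s,r]$ if there is a probability $\chi$ with a finite first moment on $C([s,r],\mathbb{T}^d\times\mathbb{R})$ such that, for each $t\in[s,r]$, $\nu(t)$ is the image of $\chi$ under $w(\cdot)\mapsto w(t)$, and $\chi$-a.e.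 $w(\cdot)$ belongs to $\mathrm{SOL}(r,s,\mathrm{p}_\#\nu(\cdot))$. For $0\le s\le r\le T$ define the set-valued map $\Psi^{r,s}:\mathcal{P}^1(\mathbb{T}^d)\times C(\mathbb{T}^d)\rightrightarrows\mathcal{P}^1(\mathbb{T}^d)\times C(\mathbb{T}^d)$ as follows: $(\mu,\psi)\in\Psi^{r,s}(m,\phi)$ if and only if there is a solution $\nu(\cdot)$ of the mean field type differential inclusion on $[s,r]$ such that $m(t)=\mathrm{p}_\#\nu(t)$ satisfies $m(s)=m$, $m(r)=\mu$, and $$\phi=B^{s,r}_{m(\cdot)}\psi,\qquad[\psi,\nu(r)]\ge[\phi,\nu(s)].$$ Then the family $\Psi=\{\Psi^{r,s}\}_{s\le r}$ is a dynamics on $\mathcal{P}^1(\mathbb{T}^d)\times C(\mathbb{T}^d)$ (the mean field game dynamics), that is, $\Psi^{s,s}(m,\phi)=\{(m,\phi)\}$ for all $s\in[0,T]$, and it has the semigroup property: for all $s_0,s_1,s_2\in[0,T]$ with $s_0<s_1<s_2$, $$\Psi^{s_2,s_0}=\Psi^{s_2,s_1}\circ\Psi^{s_1,s_0},\qquad\text{where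 } (\Phi_2\circ\Phi_1)(p)=\bigcup_{q\in\Phi_1(p)}\Phi_2(q).$$ -/

import Mathlib

open Set Filter Topology MeasureTheory

noncomputable section

namespace MFG

/-- The `d`-dimensional torus `ℝ^d / ℤ^d`. Its metric is the maximum over the coordinates of the
distance modulo `1`, which is bi-Lipschitz equivalent to the quotient of the Euclidean metric. -/
abbrev Torus (d : ℕ) : Type := UnitAddTorus (Fin d)

/-- The natural projection `ℝ^d → ℝ^d / ℤ^d`. -/
def toTorus {d : ℕ} (y : EuclideanSpace ℝ (Fin d)) : Torus d :=
  fun i => (y i : UnitAddCircle)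

/-- The Borel probabilities on the torus. The torus is compact, so that all of them have a finite
first moment. -/
abbrev ProbTorus (d : ℕ) : Type := ProbabilityMeasure (Torus d)

/-- The measure `μ` has a finite first moment: `∫ ρ(x, x₀) μ(dx) < ∞` for some point `x₀`. -/
def HasFiniteFirstMoment {X : Type*} [MetricSpace X] [MeasurableSpace X] (μ : Measure X) : Prop :=
  ∃ x₀ : X, ∫⁻ x, edist x x₀ ∂μ < ⊤

/-- The Kantorovich-Rubinstein (1-Wasserstein) distance, as the least transport cost among the
couplings of `μ` and `ν`. -/
def W1 {X : Type*} [MetricSpace X] [MeasurableSpace X] (μ ν : ProbabilityMeasure X) : ℝ :=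
  sInf {c : ℝ | ∃ π : Measure (X × X),
    π.map Prod.fst = (μ : Measure X) ∧ π.map Prod.snd = (ν : Measure X) ∧
      c = ∫ q, dist q.1 q.2 ∂π}

section Data

variable {d : ℕ} {U : Type*} [MetricSpace U]

/-- Continuity of a function on `[0,T] × 𝕋^d × 𝒫¹(𝕋^d) × U`, where `𝒫¹(𝕋^d)` carries the
metric `W1`. -/
def JointlyContinuous {V : Type*} [NormedAddCommGroup V] (T : ℝ)
    (h : ℝ → Torus d → ProbTorus d → U → V) : Prop :=
  ∀ t ∈ Icc (0 : ℝ) T, ∀ (x : Torus d) (m : ProbTorus d) (u : U), ∀ ε > 0, ∃ δ > 0,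
    ∀ t' ∈ Icc (0 : ℝ) T, ∀ (x' : Torus d) (m' : ProbTorus d) (u' : U),
      |t' - t| < δ → dist x' x < δ → W1 m' m < δ → dist u' u < δ →
        ‖h t' x' m' u' - h t x m u‖ < ε

/-- The standing assumptions on the dynamics `f` and the running payoff `g`: continuity, continuity
in time uniform in the other variables, and Lipschitz continuity in the state and the distribution
uniform in the other variables. -/
structure StandingAssumptions (T : ℝ)
    (f : ℝ → Torus d → ProbTorus d → U → EuclideanSpace ℝ (Fin d))
    (g : ℝ → Torus d → ProbTorus d → U → ℝ) : Prop where
  continuous_f : JointlyContinuous T f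
  continuous_g : JointlyContinuous T g
  modulus : ∃ α : ℝ → ℝ, (∀ δ, 0 ≤ α δ) ∧ Tendsto α (𝓝[≠] 0) (𝓝 0) ∧
    ∀ t' ∈ Icc (0 : ℝ) T, ∀ t'' ∈ Icc (0 : ℝ) T, ∀ (x : Torus d) (m : ProbTorus d) (u : U),
      ‖f t' x m u - f t'' x m u‖ ≤ α (t' - t'') ∧ |g t' x m u - g t'' x m u| ≤ α (t' - t'')
  lipschitz : ∃ L : ℝ, ∀ t ∈ Icc (0 : ℝ) T, ∀ (x' x'' : Torus d) (m' m'' : ProbTorus d) (u : U),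
      ‖f t x' m' u - f t x'' m'' u‖ ≤ L * (dist x' x'' + W1 m' m'') ∧
      |g t x' m' u - g t x'' m'' u| ≤ L * (dist x' x'' + W1 m' m'')

end Data

/-- The motions `C([s,r], 𝕋^d × ℝ)` in the extended phase space, with the supremum metric. -/
abbrev Motions (d : ℕ) (s r : ℝ) : Type := C(Icc s r, Torus d × ℝ)

instance (d : ℕ) (s r : ℝ) : MeasurableSpace (Motions d s r) := borel _

instance (d : ℕ) (s r : ℝ) : BorelSpace (Motions d s r) := ⟨rfl⟩

/-- The projection `p_# : 𝒫(𝕋^d × ℝ) → 𝒫(𝕋^d)`. -/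
def proj {d : ℕ} (ν : ProbabilityMeasure (Torus d × ℝ)) : ProbTorus d :=
  ν.map measurable_fst.aemeasurable

/-- `[φ, ν] = ∫ (φ(x) + z) ν(d(x,z))`. -/
def bracket {d : ℕ} (φ : C(Torus d, ℝ)) (ν : ProbabilityMeasure (Torus d × ℝ)) : ℝ :=
  ∫ w, (φ w.1 + w.2) ∂(ν : Measure (Torus d × ℝ))

/-- The composition `(Φ₂ ∘ Φ₁)(x) = ⋃_{y ∈ Φ₁(x)} Φ₂(y)` of set-valued maps. -/
def multiComp {X : Type*} (Φ₂ Φ₁ : X → Set X) : X → Set X :=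
  fun x => ⋃ y ∈ Φ₁ x, Φ₂ y

section Dynamics

variable {d : ℕ} {U : Type*}
  (f : ℝ → Torus d → ProbTorus d → U → EuclideanSpace ℝ (Fin d))
  (g : ℝ → Torus d → ProbTorus d → U → ℝ)

/-- `F(t,x,m) = co {(f(t,x,m,u), g(t,x,m,u)) : u ∈ U}`. -/
def vectogram (t : ℝ) (x : Torus d) (m : ProbTorus d) : Set (EuclideanSpace ℝ (Fin d) × ℝ) :=
  convexHull ℝ (range fun u : U => (f t x m u, g t x m u))

/-- The (Carathéodory) solutions on `[s,r]`, `s ≤ r`, of the differential inclusion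
`(x'(t), z'(t)) ∈ F(t, x(t), m(t))`: the absolutely continuous motions, that is, the indefinite
integrals of integrable velocities `(a, b)`, with `(a(t), b(t)) ∈ F(t, x(t), m(t))` for almost every
`t`. A flow `m` of probabilities on `[s,r]` is represented by a function on `ℝ`, of which only the
values on `[s,r]` matter. -/
def SOL {s r : ℝ} (h : s ≤ r) (m : ℝ → ProbTorus d) : Set (Motions d s r) :=
  {w | ∃ (a : ℝ → EuclideanSpace ℝ (Fin d)) (b : ℝ → ℝ),
    IntegrableOn a (Icc s r) ∧ IntegrableOn b (Icc s r) ∧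
    (∀ᵐ t : ℝ, ∀ ht : t ∈ Icc s r, (a t, b t) ∈ vectogram f g t (w ⟨t, ht⟩).1 (m t)) ∧
    ∀ (t : ℝ) (ht : t ∈ Icc s r),
      (w ⟨t, ht⟩).1 = (w ⟨s, left_mem_Icc.2 h⟩).1 + toTorus (∫ τ in s..t, a τ) ∧
      (w ⟨t, ht⟩).2 = (w ⟨s, left_mem_Icc.2 h⟩).2 + ∫ τ in s..t, b τ}

/-- The solutions of the differential inclusion with `x(s) = y`; the value `z(s)` is free. -/
def Sol {s r : ℝ} (h : s ≤ r) (y : Torus d) (m : ℝ → ProbTorus d) : Set (Motions d s r) :=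
  {w ∈ SOL f g h m | (w ⟨s, left_mem_Icc.2 h⟩).1 = y}

/-- The Bellman operator `B^{s,r}_{m(·)}`: `(Bψ)(y)` is the value of the problem to maximize
`ψ(x(r)) + z(r) - z(s)` over the solutions of the differential inclusion with `x(s) = y`. -/
def bellman {s r : ℝ} (h : s ≤ r) (m : ℝ → ProbTorus d) (ψ : C(Torus d, ℝ)) (y : Torus d) : ℝ :=
  sSup {c : ℝ | ∃ w ∈ Sol f g h y m,
    c = ψ (w ⟨r, right_mem_Icc.2 h⟩).1 + (w ⟨r, right_mem_Icc.2 h⟩).2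
      - (w ⟨s, left_mem_Icc.2 h⟩).2}

/-- The flow `ν` solves the mean field type differential inclusion
`(d/dt) ν(t) ∈ ⟨F(t, p(·), p_# ν(t)), ∇⟩ ν(t)` on `[s,r]`: there is a probability `χ` on the motions,
with a finite first moment, such that `ν(t)` is the image of `χ` under the evaluation at `t`, and
`χ`-almost every motion solves the differential inclusion for the flow `p_# ν(·)`. -/
def SolvesMFDI {s r : ℝ} (h : s ≤ r) (ν : ℝ → ProbabilityMeasure (Torus d × ℝ)) : Prop :=
  ∃ χ : ProbabilityMeasure (Motions d s r),
    HasFiniteFirstMoment (χ : Measure (Motions d s r)) ∧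
    (∀ (t : ℝ) (ht : t ∈ Icc s r),
      (ν t : Measure (Torus d × ℝ)) =
        (χ : Measure (Motions d s r)).map (fun w => w ⟨t, ht⟩)) ∧
    ∀ᵐ w ∂(χ : Measure (Motions d s r)), w ∈ SOL f g h (fun t => proj (ν t))

/-- The set-valued map `Ψ^{r,s}` of `𝒫¹(𝕋^d) × C(𝕋^d)`, for `s ≤ r`: a pair `(μ, ψ)` belongs to
`Ψ^{r,s}(m, φ)` if some solution `ν` of the mean field type differential inclusion on `[s,r]` has
`p_# ν(s) = m`, `p_# ν(r) = μ`, `φ = B^{s,r}_{p_# ν(·)} ψ` and `[ψ, ν(r)] ≥ [φ, ν(s)]`. -/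
def Psi {s r : ℝ} (h : s ≤ r) (p : ProbTorus d × C(Torus d, ℝ)) :
    Set (ProbTorus d × C(Torus d, ℝ)) :=
  {q | ∃ ν : ℝ → ProbabilityMeasure (Torus d × ℝ), SolvesMFDI f g h ν ∧
    proj (ν s) = p.1 ∧ proj (ν r) = q.1 ∧
    (∀ y, p.2 y = bellman f g h (fun t => proj (ν t)) q.2 y) ∧
    bracket p.2 (ν s) ≤ bracket q.2 (ν r)}

end Dynamics

end MFG

end

/-! The differential inclusion is local in time and its right-hand side does not involve `z`. Hence
solutions restrict to subintervals, and two solutions with the same state at `s₁` can be glued after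
a shift of the second `z`. Both facts give the dynamic programming principle `bellman_comp`: along a
fixed flow, the Bellman operator of `[s₀,s₂]` is the composition of those of `[s₀,s₁]` and
`[s₁,s₂]`. Moreover, integrating `le_bellman` over the motions gives `[ψ, ν(r)] ≤ [φ, ν(s)]`
whenever `φ = Bψ` (`bracket_le_bracket_bellman`), so the inequality required by `Psi` is really an
equality.

To split a transition at `s₁`, pass through the law of the state at `s₁` and the function
`B^{s₁,s₂}ψ`; equality over the whole interval forces equality on both pieces. The analytic point is
that `B^{s₁,s₂}ψ` is continuous (`continuous_bellman`). It rests on an approximate Filippov theorem,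
`exists_solution_near`: the velocity of a given solution is represented up to `ε` by measurable
convex weights on finitely many controls, and the Lipschitz equation with these weights frozen is
solved from a nearby initial point.

To join two transitions, `exists_concatenation` couples the two measures on motions over the common
law of the state at `s₁`. The laws of `(x, z)` at `s₁` may differ, so `z` is continued by its
increments; the two payoff inequalities then add up. -/

noncomputable section

namespace MFG

/-! ### Carathéodory equations by a weighted contraction -/

section Caratheodory

variable {E : Type*} [NormedAddCommGroup E] [NormedSpace ℝ E]

theorem continuous_extend_exp {s r : ℝ} (h : s ≤ r) (K : ℝ) (y : C(Icc s r, E)) :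
    Continuous fun τ => Real.exp (K * (τ - s)) • IccExtend h y τ := by
  have := y.continuous.Icc_extend' (h := h)
  fun_prop

/-- The Picard operator of the equation `X(t) = x₀ + ∫_s^t F(τ, X(τ)) dτ`, conjugated by the
weight `exp (K (t - s))`. -/
def weightedPicard {s r : ℝ} (h : s ≤ r) (K : ℝ) (F : ℝ → E → E)
    (hint : ∀ X : ℝ → E, Continuous X → IntegrableOn (fun t => F t (X t)) (Icc s r)) (x₀ : E)
    (y : C(Icc s r, E)) : C(Icc s r, E) where
  toFun t := Real.exp (-(K * (t - s))) •
    (x₀ + ∫ τ in s..t, F τ (Real.exp (K * (τ - s)) • IccExtend h y τ))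
  continuous_toFun := by
    have h1 := intervalIntegral.continuousOn_primitive_interval (a := s) (b := r) (μ := volume)
      (by rw [uIcc_of_le h]; exact hint _ (continuous_extend_exp h K y))
    rw [uIcc_of_le h, continuousOn_iff_continuous_domRestrict] at h1
    have h2 : Continuous fun t : Icc s r =>
        ∫ τ in s..t, F τ (Real.exp (K * (τ - s)) • IccExtend h y τ) := h1
    fun_prop

/-- The exponential weight replaces the length of the interval by `1 / K`, so that a single
contraction covers all of `[s,r]`. -/
theorem integral_exp_le {s t K : ℝ} (hK : 0 < K) :
    Real.exp (-(K * (t - s))) * ∫ τ in s..t, Real.exp (K * (τ - s)) ≤ 1 / K := by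
  have h1 : ∫ τ in s..t, Real.exp (K * (τ - s)) = (Real.exp (K * (t - s)) - 1) / K := by
    have := intervalIntegral.integral_eq_sub_of_hasDerivAt (a := s) (b := t)
      (f := fun τ => Real.exp (K * (τ - s)) / K) (f' := fun τ => Real.exp (K * (τ - s)))
      (fun τ _ => by
        have h0 : HasDerivAt (fun τ => K * (τ - s)) K τ := by
          simpa using ((hasDerivAt_id τ).sub_const s).const_mul K
        exact (h0.exp.div_const K).congr_deriv (by field_simp))
      (by apply Continuous.intervalIntegrable; fun_prop)
    rw [this]; simp; ring
  rw [h1, mul_div_assoc', mul_sub, ← Real.exp_add]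
  simp only [neg_add_cancel, Real.exp_zero, mul_one]
  gcongr
  linarith [Real.exp_pos (-(K * (t - s)))]

theorem contracting_weightedPicard {s r : ℝ} (h : s ≤ r) {L : ℝ} (hL : 0 ≤ L) (F : ℝ → E → E)
    (hF : ∀ t x y, ‖F t x - F t y‖ ≤ L * ‖x - y‖)
    (hint : ∀ X : ℝ → E, Continuous X → IntegrableOn (fun t => F t (X t)) (Icc s r)) (x₀ : E) :
    ContractingWith (1 / 2) (weightedPicard h (2 * L + 1) F hint x₀) := by
  -- The contraction factor will be `L / K`, which is at most `1 / 2`; the summand `1` keeps `K`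
  -- positive when `L = 0`.
  set K := 2 * L + 1 with hK
  have hK0 : 0 < K := by positivity
  refine ⟨by rw [← NNReal.coe_lt_coe]; norm_num, LipschitzWith.of_dist_le_mul fun y y' => ?_⟩
  rw [ContinuousMap.dist_le (by positivity)]
  rintro ⟨t, ht⟩
  have hsub : uIoc s t ⊆ Icc s r := by
    rw [uIoc_of_le ht.1]
    exact fun τ hτ => ⟨hτ.1.le, hτ.2.trans ht.2⟩
  have hi : ∀ y : C(Icc s r, E), IntervalIntegrable
      (fun τ => F τ (Real.exp (K * (τ - s)) • IccExtend h y τ)) volume s t := fun y =>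
    intervalIntegrable_iff.2 ((hint _ (continuous_extend_exp h K y)).mono_set hsub)
  simp only [weightedPicard, ContinuousMap.coe_mk]
  rw [dist_eq_norm, ← smul_sub, add_sub_add_left_eq_sub,
    ← intervalIntegral.integral_sub (hi y) (hi y'), norm_smul, Real.norm_eq_abs, Real.abs_exp]
  have hb : ‖∫ τ in s..t, (F τ (Real.exp (K * (τ - s)) • IccExtend h y τ)
      - F τ (Real.exp (K * (τ - s)) • IccExtend h y' τ))‖
      ≤ ∫ τ in s..t, L * dist y y' * Real.exp (K * (τ - s)) := by
    apply intervalIntegral.norm_integral_le_of_norm_le ht.1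
    · refine ae_of_all _ fun τ _ => (hF _ _ _).trans ?_
      rw [← smul_sub, norm_smul, Real.norm_eq_abs, Real.abs_exp, mul_assoc]
      have : ‖IccExtend h y τ - IccExtend h y' τ‖ ≤ dist y y' := by
        rw [← dist_eq_norm]; exact ContinuousMap.dist_apply_le_dist _
      nlinarith [mul_le_mul_of_nonneg_left this
        (mul_nonneg hL (Real.exp_pos (K * (τ - s))).le)]
    · apply Continuous.intervalIntegrable; fun_prop
  rw [intervalIntegral.integral_const_mul] at hb
  calc _ ≤ Real.exp (-(K * (t - s))) *
          (L * dist y y' * ∫ τ in s..t, Real.exp (K * (τ - s))) := by gcongr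
    _ = L * dist y y' * (Real.exp (-(K * (t - s))) * ∫ τ in s..t, Real.exp (K * (τ - s))) := by
        ring
    _ ≤ L * dist y y' * (1 / K) := by gcongr; exact integral_exp_le hK0
    _ = (L / K) * dist y y' := by ring
    _ ≤ _ := by
      gcongr
      rw [div_le_iff₀ hK0]; push_cast; linarith

variable [CompleteSpace E]

/-- Carathéodory's existence theorem, with an estimate for the distance of the solution to an
approximate solution `X`. -/
theorem exists_integral_solution {s r : ℝ} (h : s ≤ r) {L : ℝ} (hL : 0 ≤ L) (F : ℝ → E → E)
    (hF : ∀ t x y, ‖F t x - F t y‖ ≤ L * ‖x - y‖)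
    (hint : ∀ X : ℝ → E, Continuous X → IntegrableOn (fun t => F t (X t)) (Icc s r))
    (X : ℝ → E) (hX : Continuous X) (x₀ : E) (η : ℝ)
    (hη : ∀ t ∈ Icc s r, ‖X t - (x₀ + ∫ τ in s..t, F τ (X τ))‖ ≤ η) :
    ∃ Y : ℝ → E, Continuous Y ∧ (∀ t ∈ Icc s r, Y t = x₀ + ∫ τ in s..t, F τ (Y τ)) ∧
      ∀ t ∈ Icc s r, ‖X t - Y t‖ ≤ Real.exp ((2 * L + 1) * (r - s)) * (2 * η) := by
  have hc := contracting_weightedPicard h hL F hF hint x₀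
  set K := 2 * L + 1 with hK
  have hK0 : 0 < K := by positivity
  set Q := weightedPicard h K F hint x₀ with hQ
  have : Nonempty (Icc s r) := ⟨⟨s, left_mem_Icc.2 h⟩⟩
  have η0 : 0 ≤ η := (norm_nonneg _).trans (hη s (left_mem_Icc.2 h))
  set y : C(Icc s r, E) := ContractingWith.fixedPoint Q hc with hy
  have hfix : Q y = y := hc.fixedPoint_isFixedPt
  let X' : C(Icc s r, E) := ⟨fun t => Real.exp (-(K * (t - s))) • X t, by fun_prop⟩
  have hexp : ∀ τ (v : E), Real.exp (K * (τ - s)) • Real.exp (-(K * (τ - s))) • v = v := by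
    intro τ v
    rw [smul_smul, ← Real.exp_add]; simp
  have hX' : dist X' (Q X') ≤ η := by
    rw [ContinuousMap.dist_le η0]
    rintro ⟨t, ht⟩
    have hcongr : ∫ τ in s..t, F τ (Real.exp (K * (τ - s)) • IccExtend h X' τ)
        = ∫ τ in s..t, F τ (X τ) := by
      apply intervalIntegral.integral_congr
      intro τ hτ
      rw [uIcc_of_le ht.1] at hτ
      simp only
      rw [IccExtend_of_mem h X' ⟨hτ.1, hτ.2.trans ht.2⟩]
      simp only [X', ContinuousMap.coe_mk, hexp]
    simp only [hQ, weightedPicard, ContinuousMap.coe_mk, hcongr]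
    rw [dist_eq_norm]
    simp only [X', ContinuousMap.coe_mk]
    rw [← smul_sub, norm_smul, Real.norm_eq_abs, Real.abs_exp]
    calc _ ≤ 1 * η := by
          gcongr
          · exact Real.exp_le_one_iff.2 (by nlinarith [ht.1])
          · exact hη t ht
      _ = η := one_mul _
  -- The distance to the fixed point of a `1/2`-contraction is at most twice the first displacement.
  have hd : dist X' y ≤ 2 * η := by
    refine (hc.dist_fixedPoint_le X').trans ?_
    rw [div_le_iff₀ (by norm_num)]
    norm_num
    linarith
  refine ⟨fun t => Real.exp (K * (t - s)) • IccExtend h y t, continuous_extend_exp h K y, ?_, ?_⟩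
  · intro t ht
    simp only
    rw [IccExtend_of_mem h y ht]
    conv_lhs => rw [← hfix]
    simp only [hQ, weightedPicard, ContinuousMap.coe_mk, hexp]
  · intro t ht
    simp only
    rw [IccExtend_of_mem h y ht, ← hexp t (X t), ← smul_sub, norm_smul, Real.norm_eq_abs,
      Real.abs_exp]
    have h1 : ‖Real.exp (-(K * (t - s))) • X t - y ⟨t, ht⟩‖ ≤ 2 * η := by
      rw [← dist_eq_norm]
      exact (ContinuousMap.dist_apply_le_dist (f := X') (g := y) ⟨t, ht⟩).trans hd
    gcongr
    exact ht.2

end Caratheodory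

/-! ### Measurable near-selection and an approximate Filippov theorem -/

section Selection

/-- A measurable choice of weights which nearly represent the velocity `v`. -/
theorem exists_measurable_weights {E : Type*} [NormedAddCommGroup E] [NormedSpace ℝ E]
    [MeasurableSpace E] [BorelSpace E] [SecondCountableTopology E] {ι : Type*} [Fintype ι]
    [Nonempty ι] (v : ℝ → E) (hv : Measurable v) (k : ι → ℝ → E) (hk : ∀ i, Measurable (k i))
    {ε : ℝ} :
    ∃ l : ℝ → ι → ℝ, Measurable l ∧ (∀ t, l t ∈ stdSimplex ℝ ι) ∧
      ∀ t, (∃ q ∈ stdSimplex ℝ ι, ‖v t - ∑ i, q i • k i t‖ < ε) →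
        ‖v t - ∑ i, l t i • k i t‖ < ε := by
  classical
  have : Nonempty (stdSimplex ℝ ι) := inferInstance
  let D : ℕ → stdSimplex ℝ ι := TopologicalSpace.denseSeq _
  let P : ℕ → ℝ → Prop := fun n t => ‖v t - ∑ i, (D n).1 i • k i t‖ < ε
  have hP : ∀ n, MeasurableSet {t | P n t} := by
    intro n
    apply measurableSet_lt _ measurable_const
    apply Measurable.norm
    apply hv.sub
    apply Finset.measurable_sum
    intro i _
    exact (hk i).const_smul _
  -- The second alternative lets the search for the least index terminate also at times where no
  -- weights in the dense sequence are good.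
  let P' : ℕ → ℝ → Prop := fun n t => P n t ∨ ∀ m, ¬ P m t
  have hP' : ∀ n, MeasurableSet {t | P' n t} := fun n => by
    have : {t | P' n t} = {t | P n t} ∪ ⋂ m, {t | P m t}ᶜ := by ext t; simp [P']
    rw [this]
    exact (hP n).union (MeasurableSet.iInter fun m => (hP m).compl)
  have hex : ∀ t, ∃ n, P' n t := by
    intro t
    by_cases h : ∃ n, P n t
    · obtain ⟨n, hn⟩ := h; exact ⟨n, Or.inl hn⟩
    · push Not at h; exact ⟨0, Or.inr h⟩
  refine ⟨fun t => (D (Nat.find (hex t))).1, ?_, fun t => (D _).2, ?_⟩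
  · exact Measurable.find (f := fun n _ => (D n).1) (fun n => measurable_const) hP' hex
  · rintro t ⟨q, hq, hqε⟩
    have hopen : IsOpen {q : stdSimplex ℝ ι | ‖v t - ∑ i, q.1 i • k i t‖ < ε} := by
      have hi : ∀ i, Continuous fun q : stdSimplex ℝ ι => q.1 i := fun i =>
        (continuous_apply i).comp continuous_subtype_val
      exact isOpen_lt (continuous_const.sub
        (continuous_finsetSum _ fun i _ => (hi i).smul continuous_const)).norm continuous_const
    obtain ⟨n, hn⟩ := (TopologicalSpace.denseRange_denseSeq _).exists_mem_open hopen
      ⟨⟨q, hq⟩, hqε⟩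
    rcases Nat.find_spec (hex t) with h | h
    · exact h
    · exact absurd hn (h n)

/-- A point of a convex hull is nearly a convex combination of the points of a net. -/
theorem exists_stdSimplex_of_mem_convexHull {E : Type*} [NormedAddCommGroup E] [NormedSpace ℝ E]
    {ι : Type*} [Fintype ι] (k : ι → E) (S : Set E) {ε : ℝ}
    (hS : ∀ p ∈ S, ∃ i, ‖p - k i‖ < ε) {p : E} (hp : p ∈ convexHull ℝ S) :
    ∃ q ∈ stdSimplex ℝ ι, ‖p - ∑ i, q i • k i‖ < ε := by
  classical
  have hconv : Convex ℝ {p : E | ∃ q ∈ stdSimplex ℝ ι, ‖p - ∑ i, q i • k i‖ < ε} := by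
    rintro x ⟨q, hq, hx⟩ y ⟨q', hq', hy⟩ a b ha hb hab
    refine ⟨a • q + b • q', convex_stdSimplex ℝ ι hq hq' ha hb hab, ?_⟩
    have : a • x + b • y - ∑ i, (a • q + b • q') i • k i
        = a • (x - ∑ i, q i • k i) + b • (y - ∑ i, q' i • k i) := by
      simp only [Pi.add_apply, Pi.smul_apply, smul_eq_mul, add_smul, Finset.sum_add_distrib,
        smul_sub, Finset.smul_sum, mul_smul]
      abel
    rw [this, ← mem_ball_zero_iff]
    exact convex_ball 0 ε (mem_ball_zero_iff.2 hx) (mem_ball_zero_iff.2 hy) ha hb hab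
  refine convexHull_min (fun x hx => ?_) hconv hp
  obtain ⟨i, hi⟩ := hS x hx
  exact ⟨Pi.single i 1, single_mem_stdSimplex ℝ i, by simpa [Pi.single_apply, ite_smul] using hi⟩

/-- A finite net of controls, uniform along a trajectory. -/
theorem exists_finite_net_controls {E : Type*} [NormedAddCommGroup E] {U : Type*}
    [TopologicalSpace U] [CompactSpace U] [Nonempty U] (s r : ℝ) (k : ℝ → U → E)
    (hk : Continuous fun p : ℝ × U => k p.1 p.2) {ε : ℝ} (hε : 0 < ε) :
    ∃ (ι : Type) (_ : Fintype ι) (_ : Nonempty ι) (u : ι → U),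
      ∀ t ∈ Icc s r, ∀ u', ∃ i, ‖k t u' - k t (u i)‖ < ε := by
  -- As a continuous map from the compact `U` into curves with the supremum norm, `Φ` has a finite
  -- net that serves all times at once.
  let Φ : C(U, C(Icc s r, E)) := ContinuousMap.curry
    ⟨fun p : U × Icc s r => k p.2 p.1, hk.comp (by fun_prop : Continuous fun p : U × Icc s r =>
      ((p.2 : ℝ), p.1))⟩
  obtain ⟨N, hN⟩ : ∃ N : Finset U, univ ⊆ ⋃ u ∈ N, Φ ⁻¹' Metric.ball (Φ u) ε := by
    refine isCompact_univ.elim_finite_subcover _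
      (fun u => Metric.isOpen_ball.preimage Φ.continuous) ?_ |>.imp fun N h => h
    exact fun u _ => mem_iUnion.2 ⟨u, Metric.mem_ball_self hε⟩
  obtain ⟨n, ⟨e⟩⟩ : ∃ n, Nonempty (N ≃ Fin n) := ⟨_, ⟨Finset.equivFin N⟩⟩
  have hnet : ∀ t ∈ Icc s r, ∀ u', ∃ i, ‖k t u' - k t (e.symm i)‖ < ε := by
    intro t ht u'
    obtain ⟨u, hu, hmem⟩ := mem_iUnion₂.1 (hN (mem_univ u'))
    refine ⟨e ⟨u, hu⟩, ?_⟩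
    rw [Equiv.symm_apply_apply, ← dist_eq_norm]
    exact (ContinuousMap.dist_apply_le_dist (f := Φ u') (g := Φ u) ⟨t, ht⟩).trans_lt hmem
  have hn : Nonempty (Fin n) := by
    obtain ⟨u'⟩ := ‹Nonempty U›
    obtain ⟨u, hu, -⟩ := mem_iUnion₂.1 (hN (mem_univ u'))
    exact ⟨e ⟨u, hu⟩⟩
  exact ⟨Fin n, inferInstance, hn, fun i => e.symm i, hnet⟩

/-- An approximate version of Filippov's theorem: close to a solution of the differential inclusion
there is a solution with any nearby initial point. -/
theorem exists_solution_near {E : Type*} [NormedAddCommGroup E] [NormedSpace ℝ E]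
    [CompleteSpace E] [MeasurableSpace E] [BorelSpace E] [SecondCountableTopology E]
    {U : Type*} [TopologicalSpace U] [CompactSpace U] [Nonempty U] {s r : ℝ} (hsr : s ≤ r)
    {L : ℝ} (hL : 0 ≤ L) (h : ℝ → E → U → E)
    (hcont : Continuous fun p : ℝ × E × U => h p.1 p.2.1 p.2.2)
    (hlip : ∀ t x y u, ‖h t x u - h t y u‖ ≤ L * ‖x - y‖) (v : ℝ → E)
    (hv : IntegrableOn v (Icc s r)) (W : ℝ → E) (hW : Continuous W)
    (hWv : ∀ t ∈ Icc s r, W t = W s + ∫ τ in s..t, v τ)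
    (hmem : ∀ᵐ t, t ∈ Icc s r → v t ∈ convexHull ℝ (range (h t (W t)))) (x₀ : E) {ε : ℝ}
    (hε : 0 < ε) :
    ∃ v' W' : ℝ → E, IntegrableOn v' (Icc s r) ∧ Continuous W' ∧
      (∀ t ∈ Icc s r, W' t = x₀ + ∫ τ in s..t, v' τ) ∧
      (∀ t, v' t ∈ convexHull ℝ (range (h t (W' t)))) ∧
      ∀ t ∈ Icc s r, ‖W t - W' t‖ ≤
        Real.exp ((2 * L + 1) * (r - s)) * (2 * (‖W s - x₀‖ + ε * (r - s))) := by
  have hkc : Continuous fun p : ℝ × U => h p.1 (W p.1) p.2 :=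
    hcont.comp (by fun_prop : Continuous fun p : ℝ × U => (p.1, W p.1, p.2))
  obtain ⟨ι, _, _, u, hu⟩ := exists_finite_net_controls s r (fun t u => h t (W t) u) hkc hε
  have hcomp : ∀ (X : ℝ → E), Continuous X → ∀ i, Continuous fun t => h t (X t) (u i) :=
    fun X hX i => hcont.comp (by fun_prop : Continuous fun t => (t, X t, u i))
  set v₁ := hv.1.mk v with hv₁
  have hvv : ∀ᵐ t, t ∈ Icc s r → v t = v₁ t :=
    (ae_restrict_iff' measurableSet_Icc).1 hv.1.ae_eq_mk
  obtain ⟨l, hlm, hls, hl⟩ := exists_measurable_weights (ε := ε) v₁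
    hv.1.stronglyMeasurable_mk.measurable (fun i t => h t (W t) (u i))
    (fun i => (hcomp W hW i).measurable)
  have hlW : ∀ᵐ t, t ∈ Icc s r → ‖v t - ∑ i, l t i • h t (W t) (u i)‖ ≤ ε := by
    filter_upwards [hvv, hmem] with t h1 h2 ht
    rw [h1 ht]
    refine (hl t ?_).le
    apply exists_stdSimplex_of_mem_convexHull (S := range (h t (W t)))
    · rintro _ ⟨u', rfl⟩
      exact hu t ht u'
    · rw [← h1 ht]; exact h2 ht
  -- The weights depend on time only. So `F` inherits the Lipschitz constant of `h`, its values are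
  -- admissible velocities at every state, and along `W` it is within `ε` of `v`.
  let F : ℝ → E → E := fun t x => ∑ i, l t i • h t x (u i)
  have hF : ∀ t x y, ‖F t x - F t y‖ ≤ L * ‖x - y‖ := by
    intro t x y
    simp only [F]
    rw [← Finset.sum_sub_distrib]
    calc _ ≤ ∑ i, l t i * (L * ‖x - y‖) := by
          refine norm_sum_le_of_le _ fun i _ => ?_
          rw [← smul_sub, norm_smul, Real.norm_of_nonneg ((hls t).1 i)]
          exact mul_le_mul_of_nonneg_left (hlip _ _ _ _) ((hls t).1 i)
      _ = _ := by rw [← Finset.sum_mul, (hls t).2, one_mul]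
  have hint : ∀ X : ℝ → E, Continuous X → IntegrableOn (fun t => F t (X t)) (Icc s r) := by
    intro X hX
    refine integrable_finsetSum _ fun i _ => ?_
    refine Integrable.bdd_smul (hcomp X hX i).integrableOn_Icc 1 ?_ (ae_of_all _ fun t => ?_)
    · exact ((measurable_pi_apply i).comp hlm).aestronglyMeasurable
    · rw [Real.norm_of_nonneg ((hls t).1 i), ← (hls t).2]
      exact Finset.single_le_sum (fun j _ => (hls t).1 j) (Finset.mem_univ i)
  obtain ⟨Y, hYc, hYi, hYn⟩ := exists_integral_solution hsr hL F hF hint W hW x₀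
    (‖W s - x₀‖ + ε * (r - s)) (by
      intro t ht
      have hsub : uIoc s t ⊆ Icc s r := by
        rw [uIoc_of_le ht.1]
        exact fun τ hτ => ⟨hτ.1.le, hτ.2.trans ht.2⟩
      rw [hWv t ht, add_sub_add_comm, ← intervalIntegral.integral_sub
        (intervalIntegrable_iff.2 (hv.mono_set hsub))
        (intervalIntegrable_iff.2 ((hint W hW).mono_set hsub))]
      refine (norm_add_le _ _).trans (add_le_add le_rfl ?_)
      refine (intervalIntegral.norm_integral_le_of_norm_le_const_ae (C := ε) ?_).trans ?_
      · filter_upwards [hlW] with τ hτ hm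
        exact hτ (hsub hm)
      · rw [abs_of_nonneg (by linarith [ht.1])]
        gcongr
        exact ht.2)
  refine ⟨fun t => F t (Y t), Y, hint Y hYc, hYc, hYi, fun t => ?_, hYn⟩
  refine (convex_convexHull ℝ _).sum_mem (fun i _ => (hls t).1 i) (hls t).2 fun i _ => ?_
  exact subset_convexHull ℝ _ (mem_range_self _)

end Selection

/-! ### Images of almost sure properties; gluing of measures -/

section Measures

/-- An almost sure property of `R x` is almost sure for the image measure, even if the property is
not measurable. -/
theorem ae_map_of_ae_comp {X Y : Type*} [MetricSpace X] [CompleteSpace X]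
    [SecondCountableTopology X] [MeasurableSpace X] [BorelSpace X] [TopologicalSpace Y] [T2Space Y] [MeasurableSpace Y] [BorelSpace Y]
    (μ : Measure X) [IsFiniteMeasure μ] {R : X → Y} (hR : Continuous R) {P : Y → Prop}
    (h : ∀ᵐ x ∂μ, P (R x)) : ∀ᵐ y ∂μ.map R, P y := by
  obtain ⟨A, hAP, hA, hA0⟩ := exists_measurable_superset_of_null (ae_iff.1 h)
  -- Compact sets exhaust `Aᶜ` up to a null set. Their images under `R` are compact, hence
  -- measurable, and `P` holds on them, which avoids any measurability of `P`.
  have hK : ∀ n : ℕ, ∃ K ⊆ Aᶜ, IsCompact K ∧ μ Aᶜ < μ K + ((n : ENNReal) + 1)⁻¹ := fun n =>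
    hA.compl.exists_isCompact_lt_add (measure_ne_top _ _) (by simp)
  choose K hKA hKc hKμ using hK
  have hS : MeasurableSet (⋃ n, R '' K n) :=
    MeasurableSet.iUnion fun n => ((hKc n).image hR).measurableSet
  rw [ae_iff]
  refine measure_mono_null (t := (⋃ n, R '' K n)ᶜ) ?_ ?_
  · intro y hy hy'
    obtain ⟨n, x, hx, rfl⟩ := mem_iUnion.1 hy'
    exact hKA n hx (hAP hy)
  · rw [Measure.map_apply hR.measurable hS.compl]
    refine le_antisymm (ENNReal.le_of_forall_pos_le_add fun ε hε _ => ?_) zero_le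
    obtain ⟨n, hn⟩ := ENNReal.exists_inv_nat_lt (a := (ε : ENNReal)) (by simpa using hε.ne')
    have h1 : R ⁻¹' (⋃ n, R '' K n)ᶜ ⊆ A ∪ (Aᶜ \ K n) := by
      intro x hx
      by_cases hxA : x ∈ A
      · exact Or.inl hxA
      · exact Or.inr ⟨hxA, fun hxK => hx (mem_iUnion.2 ⟨n, x, hxK, rfl⟩)⟩
    have hKm : NullMeasurableSet (K n) μ := (hKc n).measurableSet.nullMeasurableSet
    calc _ ≤ μ A + μ (Aᶜ \ K n) := (measure_mono h1).trans (measure_union_le _ _)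
      _ = μ Aᶜ - μ (K n) := by rw [hA0, zero_add, measure_sdiff (hKA n) hKm (measure_ne_top _ _)]
      _ ≤ ((n : ENNReal) + 1)⁻¹ := by
        rw [tsub_le_iff_left]; exact (hKμ n).le
      _ ≤ (n : ENNReal)⁻¹ := by gcongr; exact le_self_add
      _ ≤ 0 + ε := by rw [zero_add]; exact hn.le

/-- The gluing lemma: measures whose images under `e₁` and `e₂` agree are the marginals of a
measure which is concentrated on `e₁ x = e₂ y`. -/
theorem exists_gluing {X Y Z : Type*} [MeasurableSpace X] [MeasurableSpace Y]
    [StandardBorelSpace Y] [Nonempty Y] [MeasurableSpace Z] [MeasurableEq Z] (μ : Measure X)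
    [IsProbabilityMeasure μ] (ν : Measure Y) [IsProbabilityMeasure ν] {e₁ : X → Z} {e₂ : Y → Z}
    (h₁ : Measurable e₁) (h₂ : Measurable e₂) (h : μ.map e₁ = ν.map e₂) :
    ∃ γ : ProbabilityMeasure (X × Y), (γ : Measure (X × Y)).map Prod.fst = μ ∧
      (γ : Measure (X × Y)).map Prod.snd = ν ∧ ∀ᵐ p ∂(γ : Measure (X × Y)), e₁ p.1 = e₂ p.2 := by
  -- Draw `x` from `μ`, then `y` from the conditional law of `ν` given `e₂ y = e₁ x`.
  let κ := ProbabilityTheory.condDistrib id e₂ ν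
  let γ := μ.compProd (κ.comap e₁ h₁)
  have hm : Measurable fun p : X × Y => (e₁ p.1, p.2) := by fun_prop
  have hγ : γ.map (fun p => (e₁ p.1, p.2)) = ν.map fun y => (e₂ y, y) := by
    have h3 : (ν.map e₂).compProd κ = ν.map fun y => (e₂ y, y) :=
      ProbabilityTheory.compProd_map_condDistrib (X := e₂) (Y := id) aemeasurable_id
    rw [← h3]
    ext S hS
    have : IsFiniteMeasure (ν.map e₂) := inferInstance
    rw [Measure.map_apply hm hS, Measure.compProd_apply (hm hS), Measure.compProd_apply hS, ← h,
      lintegral_map (ProbabilityTheory.Kernel.measurable_kernel_prodMk_left hS) h₁]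
    rfl
  refine ⟨⟨γ, inferInstance⟩, ?_, ?_, ?_⟩
  · exact Measure.fst_compProd μ _
  · have := congrArg (Measure.map Prod.snd) hγ
    rw [Measure.map_map measurable_snd hm, Measure.map_map measurable_snd (by fun_prop)] at this
    simpa [Function.comp_def] using this
  · have : ∀ᵐ q ∂γ.map (fun p => (e₁ p.1, p.2)), q.1 = e₂ q.2 := by
      have hy : Measurable fun y => (e₂ y, y) := by fun_prop
      have hS : MeasurableSet {q : Z × Y | q.1 = e₂ q.2} :=
        measurableSet_eq_fun measurable_fst (h₂.comp measurable_snd)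
      rw [hγ]
      exact (ae_map_iff hy.aemeasurable hS).2 (ae_of_all _ fun _ => rfl)
    exact ae_of_ae_map hm.aemeasurable this

end Measures

/-! ### Finite first moments -/

section FirstMoment

variable {X Y : Type*} [MetricSpace X] [MeasurableSpace X] [MetricSpace Y] [MeasurableSpace Y]

theorem HasFiniteFirstMoment.lintegral_lt_top {μ : Measure X} [IsFiniteMeasure μ]
    (h : HasFiniteFirstMoment μ) (x₁ : X) : ∫⁻ x, edist x x₁ ∂μ < ⊤ := by
  obtain ⟨x₀, h₀⟩ := h
  calc _ ≤ ∫⁻ x, (edist x x₀ + edist x₀ x₁) ∂μ := lintegral_mono fun x => edist_triangle _ _ _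
    _ = ∫⁻ x, edist x x₀ ∂μ + edist x₀ x₁ * μ univ := by
      rw [lintegral_add_right _ measurable_const, lintegral_const]
    _ < ⊤ := ENNReal.add_lt_top.2 ⟨h₀, ENNReal.mul_lt_top (edist_lt_top _ _) (measure_lt_top _ _)⟩

variable [BorelSpace X]

theorem HasFiniteFirstMoment.map [BorelSpace Y] {μ : Measure X} (h : HasFiniteFirstMoment μ)
    {R : X → Y} {K : NNReal} (hR : LipschitzWith K R) : HasFiniteFirstMoment (μ.map R) := by
  obtain ⟨x₀, h₀⟩ := h
  refine ⟨R x₀, ?_⟩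
  rw [lintegral_map (measurable_edist_left) hR.continuous.measurable]
  refine (lintegral_mono fun x => hR x x₀).trans_lt ?_
  rw [lintegral_const_mul _ measurable_edist_left]
  exact ENNReal.mul_lt_top ENNReal.coe_lt_top h₀

theorem HasFiniteFirstMoment.prod [BorelSpace Y] {γ : Measure (X × Y)}
    (h₁ : HasFiniteFirstMoment (γ.map Prod.fst)) (h₂ : HasFiniteFirstMoment (γ.map Prod.snd)) :
    HasFiniteFirstMoment γ := by
  obtain ⟨x₀, hx⟩ := h₁
  obtain ⟨y₀, hy⟩ := h₂
  rw [lintegral_map measurable_edist_left (by fun_prop)] at hx hy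
  refine ⟨(x₀, y₀), ?_⟩
  calc _ ≤ ∫⁻ p : X × Y, (edist p.1 x₀ + edist p.2 y₀) ∂γ := lintegral_mono fun p => by
        rw [Prod.edist_eq]; exact max_le le_self_add le_add_self
    _ = _ := lintegral_add_left (measurable_edist_left.comp measurable_fst) _
    _ < ⊤ := ENNReal.add_lt_top.2 ⟨hx, hy⟩

/-- Real functions of linear growth are integrable. -/
theorem HasFiniteFirstMoment.integrable {μ : Measure X} [IsFiniteMeasure μ]
    (h : HasFiniteFirstMoment μ) {F : X → ℝ} (hF : Continuous F) (x₀ : X) (C : ℝ)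
    (hC : ∀ x, |F x| ≤ C + dist x x₀) : Integrable F μ := by
  have hd : Integrable (fun x => dist x x₀) μ := by
    refine ⟨(continuous_id.dist continuous_const).measurable.aestronglyMeasurable, ?_⟩
    rw [hasFiniteIntegral_iff_norm]
    refine lt_of_eq_of_lt (lintegral_congr fun x => ?_) (h.lintegral_lt_top x₀)
    rw [Real.norm_of_nonneg dist_nonneg, edist_dist]
  exact ((integrable_const C).add hd).mono' hF.measurable.aestronglyMeasurable (ae_of_all _ hC)

end FirstMoment

/-! ### Continuity in the Kantorovich–Rubinstein metric -/

section Wasserstein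

variable {X : Type*} [MetricSpace X] [MeasurableSpace X]

theorem W1_le {μ ν : ProbabilityMeasure X} {π : Measure (X × X)}
    (h₁ : π.map Prod.fst = (μ : Measure X)) (h₂ : π.map Prod.snd = (ν : Measure X)) :
    W1 μ ν ≤ ∫ q, dist q.1 q.2 ∂π := by
  refine csInf_le ⟨0, ?_⟩ ⟨π, h₁, h₂, rfl⟩
  rintro _ ⟨π, -, -, rfl⟩
  exact integral_nonneg fun _ => dist_nonneg

/-- The distributions of a random continuous curve in a compact space depend continuously on the
time with respect to the metric `W1`. -/
theorem tendsto_W1_of_map [BorelSpace X] [CompactSpace X] {Ω S : Type*} [MeasurableSpace Ω]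
    [TopologicalSpace S] [FirstCountableTopology S] (χ : Measure Ω) [IsProbabilityMeasure χ]
    (e : S → Ω → X) (he : ∀ t, Measurable (e t)) (hc : ∀ w, Continuous fun t => e t w)
    (m : S → ProbabilityMeasure X) (hm : ∀ t, (m t : Measure X) = χ.map (e t)) (t : S) :
    Tendsto (fun t' => W1 (m t') (m t)) (𝓝 t) (𝓝 0) := by
  -- The joint law of the curve at the two times is a coupling; its cost tends to zero by dominated
  -- convergence.
  have hle : ∀ t', W1 (m t') (m t) ≤ ∫ w, dist (e t' w) (e t w) ∂χ := by
    intro t'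
    have hp : Measurable fun w => (e t' w, e t w) := (he t').prodMk (he t)
    refine (W1_le (π := χ.map fun w => (e t' w, e t w)) ?_ ?_).trans_eq ?_
    · rw [Measure.map_map measurable_fst hp, hm]; rfl
    · rw [Measure.map_map measurable_snd hp, hm]; rfl
    · rw [integral_map hp.aemeasurable]
      exact (continuous_dist).measurable.aestronglyMeasurable
  refine squeeze_zero (fun t' => ?_) hle ?_
  · refine Real.sInf_nonneg ?_
    rintro _ ⟨π, -, -, rfl⟩
    exact integral_nonneg fun _ => dist_nonneg
  · have h0 : ∫ w, dist (e t w) (e t w) ∂χ = 0 := by simp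
    rw [← h0]
    refine tendsto_integral_filter_of_dominated_convergence (fun _ => Metric.diam (univ : Set X))
      (Eventually.of_forall fun t' => ((he t').dist (he t)).aestronglyMeasurable)
      (Eventually.of_forall fun t' => ae_of_all _ fun w => ?_) (integrable_const _)
      (ae_of_all _ fun w => ?_)
    · rw [Real.norm_of_nonneg dist_nonneg]
      exact Metric.dist_le_diam_of_mem isCompact_univ.isBounded (mem_univ _) (mem_univ _)
    · exact (((hc w).dist continuous_const).tendsto t)

end Wasserstein

/-! ### The torus and its universal cover -/

section TorusLemmas

variable {d : ℕ}

theorem toTorus_add (y y' : EuclideanSpace ℝ (Fin d)) :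
    toTorus (y + y') = toTorus y + toTorus y' := by
  ext i; simp [toTorus]

theorem toTorus_zero : toTorus (0 : EuclideanSpace ℝ (Fin d)) = 0 := by
  ext i; simp [toTorus]

theorem continuous_toTorus : Continuous (toTorus (d := d)) := by
  refine continuous_pi fun i => ?_
  exact (AddCircle.continuous_mk' 1).comp (EuclideanSpace.proj (𝕜 := ℝ) i).continuous

theorem dist_toTorus_le (y y' : EuclideanSpace ℝ (Fin d)) :
    dist (toTorus y) (toTorus y') ≤ ‖y - y'‖ := by
  refine (dist_pi_le_iff (norm_nonneg _)).2 fun i => ?_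
  rw [dist_eq_norm]
  have h : toTorus y i - toTorus y' i = (((y - y') i : ℝ) : UnitAddCircle) := by simp [toTorus]
  rw [h, UnitAddCircle.norm_eq]
  exact (round_le _ 0).trans (by simpa using PiLp.norm_apply_le (y - y') i)

/-- Each coordinate is lifted to its representative nearest to zero. The factor `√d` compares the
Euclidean norm upstairs with the maximum norm on the torus. -/
theorem exists_toTorus_eq (x : Torus d) :
    ∃ y : EuclideanSpace ℝ (Fin d), toTorus y = x ∧ ‖y‖ ≤ √d * ‖x‖ := by
  have h : ∀ i, ∃ a : ℝ, (a : UnitAddCircle) = x i ∧ |a| = ‖x i‖ := by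
    intro i
    obtain ⟨b, hb⟩ := QuotientAddGroup.mk_surjective (x i)
    refine ⟨b - round b, ?_, ?_⟩
    · rw [← hb]
      have : ((round b : ℝ) : UnitAddCircle) = 0 := by
        rw [AddCircle.coe_eq_zero_iff]; exact ⟨round b, by simp⟩
      rw [AddCircle.coe_sub, this, sub_zero]
    · rw [← hb]; exact (UnitAddCircle.norm_eq (x := b)).symm
  choose a ha hn using h
  refine ⟨WithLp.toLp 2 a, funext fun i => ha i, ?_⟩
  rw [EuclideanSpace.norm_eq]
  calc _ ≤ √(∑ _i : Fin d, ‖x‖ ^ 2) := by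
        gcongr with i
        simp only [Real.norm_eq_abs, hn]
        exact norm_le_pi_norm x i
    _ = _ := by simp [Real.sqrt_sq]

end TorusLemmas

/-! ### Restriction, shift and gluing of solutions -/

section Solutions

variable {d : ℕ} {U : Type*}
  {f : ℝ → Torus d → ProbTorus d → U → EuclideanSpace ℝ (Fin d)}
  {g : ℝ → Torus d → ProbTorus d → U → ℝ}

theorem SOL_congr {s r : ℝ} (h : s ≤ r) {m m' : ℝ → ProbTorus d}
    (hm : ∀ t ∈ Icc s r, m t = m' t) : SOL f g h m = SOL f g h m' := by
  have key : ∀ m m' : ℝ → ProbTorus d, (∀ t ∈ Icc s r, m t = m' t) →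
      SOL f g h m ⊆ SOL f g h m' := by
    rintro m m' hm w ⟨a, b, ha, hb, hv, hw⟩
    refine ⟨a, b, ha, hb, ?_, hw⟩
    filter_upwards [hv] with t ht ht'
    rw [← hm t ht']
    exact ht ht'
  exact (key m m' hm).antisymm (key m' m fun t ht => (hm t ht).symm)

theorem bellman_congr {s r : ℝ} (h : s ≤ r) {m m' : ℝ → ProbTorus d}
    (hm : ∀ t ∈ Icc s r, m t = m' t) : bellman f g h m = bellman f g h m' := by
  funext ψ y
  simp only [bellman, Sol, SOL_congr h hm]

/-- The restriction of a motion to a subinterval. -/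
def restrictMotion {s r s' r' : ℝ} (hs : s' ≤ s) (hr : r ≤ r') (w : Motions d s' r') :
    Motions d s r :=
  w.comp ⟨inclusion (Icc_subset_Icc hs hr), continuous_inclusion _⟩

theorem restrictMotion_apply {s r s' r' : ℝ} (hs : s' ≤ s) (hr : r ≤ r') (w : Motions d s' r')
    {t : ℝ} (ht : t ∈ Icc s r) :
    restrictMotion hs hr w ⟨t, ht⟩ = w ⟨t, Icc_subset_Icc hs hr ht⟩ := rfl

theorem intervalIntegrable_of_mem {F : Type*} [NormedAddCommGroup F] {v : ℝ → F} {s r a b : ℝ}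
    (hv : IntegrableOn v (Icc s r)) (ha : a ∈ Icc s r) (hb : b ∈ Icc s r) :
    IntervalIntegrable v volume a b :=
  (hv.mono_set (uIcc_subset_Icc ha hb)).intervalIntegrable

theorem restrictMotion_mem_SOL {s r s' r' : ℝ} (hs : s' ≤ s) (h : s ≤ r) (hr : r ≤ r')
    {m : ℝ → ProbTorus d} {w : Motions d s' r'}
    (hw : w ∈ SOL f g (hs.trans (h.trans hr)) m) : restrictMotion hs hr w ∈ SOL f g h m := by
  obtain ⟨a, b, ha, hb, hv, hw⟩ := hw
  have hsub := Icc_subset_Icc hs hr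
  refine ⟨a, b, ha.mono_set hsub, hb.mono_set hsub, ?_, ?_⟩
  · filter_upwards [hv] with t ht ht'
    exact ht (hsub ht')
  · intro t ht
    have h0 : s' ∈ Icc s' r' := left_mem_Icc.2 (hs.trans (h.trans hr))
    have h1 := hw t (hsub ht)
    have h2 := hw s (hsub (left_mem_Icc.2 h))
    simp only [restrictMotion_apply]
    rw [h1.1, h1.2, h2.1, h2.2, add_assoc, add_assoc, ← toTorus_add,
      intervalIntegral.integral_add_adjacent_intervals,
      intervalIntegral.integral_add_adjacent_intervals]
    · exact ⟨rfl, rfl⟩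
    all_goals
      refine intervalIntegrable_of_mem (by assumption) ?_ ?_
    all_goals first | exact h0 | exact hsub ht | exact hsub (left_mem_Icc.2 h)

theorem mem_SOL_of_restrictMotion {s₀ s₁ s₂ : ℝ} (h₀₁ : s₀ ≤ s₁) (h₁₂ : s₁ ≤ s₂)
    {m : ℝ → ProbTorus d} {w : Motions d s₀ s₂}
    (hw₁ : restrictMotion le_rfl h₁₂ w ∈ SOL f g h₀₁ m)
    (hw₂ : restrictMotion h₀₁ le_rfl w ∈ SOL f g h₁₂ m) :
    w ∈ SOL f g (h₀₁.trans h₁₂) m := by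
  classical
  obtain ⟨a₁, b₁, ha₁, hb₁, hv₁, hw₁⟩ := hw₁
  obtain ⟨a₂, b₂, ha₂, hb₂, hv₂, hw₂⟩ := hw₂
  have hunion : Icc s₀ s₂ = Icc s₀ s₁ ∪ Ioc s₁ s₂ := (Icc_union_Ioc_eq_Icc h₀₁ h₁₂).symm
  have hint : ∀ {F : Type} [NormedAddCommGroup F] (v₁ v₂ : ℝ → F), IntegrableOn v₁ (Icc s₀ s₁) →
      IntegrableOn v₂ (Icc s₁ s₂) → IntegrableOn (fun t => if t ≤ s₁ then v₁ t else v₂ t)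
        (Icc s₀ s₂) := by
    intro F _ v₁ v₂ h1 h2
    rw [hunion]
    refine IntegrableOn.union (h1.congr_fun (fun t ht => ?_) measurableSet_Icc)
      ((h2.mono_set Ioc_subset_Icc_self).congr_fun (fun t ht => ?_) measurableSet_Ioc)
    · simp [ht.2]
    · simp [ht.1]
  have hI₁ : ∀ {F : Type} [NormedAddCommGroup F] [NormedSpace ℝ F] (v₁ v₂ : ℝ → F),
      ∀ t ∈ Icc s₀ s₁, ∫ τ in s₀..t, (if τ ≤ s₁ then v₁ τ else v₂ τ) = ∫ τ in s₀..t, v₁ τ := by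
    intro F _ _ v₁ v₂ t ht
    refine intervalIntegral.integral_congr fun τ hτ => ?_
    rw [uIcc_of_le ht.1] at hτ
    simp [hτ.2.trans ht.2]
  have hI₂ : ∀ {F : Type} [NormedAddCommGroup F] [NormedSpace ℝ F] (v₁ v₂ : ℝ → F),
      IntegrableOn v₁ (Icc s₀ s₁) → IntegrableOn v₂ (Icc s₁ s₂) → ∀ t ∈ Icc s₁ s₂,
      ∫ τ in s₀..t, (if τ ≤ s₁ then v₁ τ else v₂ τ)
        = (∫ τ in s₀..s₁, v₁ τ) + ∫ τ in s₁..t, v₂ τ := by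
    intro F _ _ v₁ v₂ h1 h2 t ht
    have h3 := hint v₁ v₂ h1 h2
    rw [← intervalIntegral.integral_add_adjacent_intervals
      (intervalIntegrable_of_mem h3 (left_mem_Icc.2 (h₀₁.trans h₁₂)) ⟨h₀₁, h₁₂⟩)
      (intervalIntegrable_of_mem h3 ⟨h₀₁, h₁₂⟩ ⟨h₀₁.trans ht.1, ht.2⟩),
      hI₁ v₁ v₂ s₁ (right_mem_Icc.2 h₀₁)]
    congr 1
    refine intervalIntegral.integral_congr_ae (ae_of_all _ fun τ hτ => ?_)
    rw [uIoc_of_le ht.1] at hτ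
    simp [hτ.1]
  refine ⟨fun t => if t ≤ s₁ then a₁ t else a₂ t, fun t => if t ≤ s₁ then b₁ t else b₂ t,
    hint _ _ ha₁ ha₂, hint _ _ hb₁ hb₂, ?_, ?_⟩
  · filter_upwards [hv₁, hv₂] with t h1 h2 ht
    by_cases h : t ≤ s₁
    · simp only [h, if_true]
      exact h1 ⟨ht.1, h⟩
    · simp only [h, if_false]
      exact h2 ⟨(not_le.1 h).le, ht.2⟩
  · intro t ht
    by_cases h : t ≤ s₁
    · rw [hI₁ a₁ a₂ t ⟨ht.1, h⟩, hI₁ b₁ b₂ t ⟨ht.1, h⟩]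
      exact hw₁ t ⟨ht.1, h⟩
    · have ht' : t ∈ Icc s₁ s₂ := ⟨(not_le.1 h).le, ht.2⟩
      rw [hI₂ a₁ a₂ ha₁ ha₂ t ht', hI₂ b₁ b₂ hb₁ hb₂ t ht', toTorus_add, ← add_assoc, ← add_assoc]
      have h1 := hw₁ s₁ (right_mem_Icc.2 h₀₁)
      have h2 := hw₂ t ht'
      simp only [restrictMotion_apply] at h1 h2
      rw [← h1.1, ← h1.2]
      exact h2

/-- The admissible velocities depend on `x` but not on `z`, so the same `(a, b)` serves the shifted
motion. -/
theorem mem_SOL_of_shift {s r : ℝ} (h : s ≤ r) {m : ℝ → ProbTorus d} {w w' : Motions d s r}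
    (hw : w ∈ SOL f g h m) (c : ℝ) (h₁ : ∀ t, (w' t).1 = (w t).1)
    (h₂ : ∀ t, (w' t).2 = (w t).2 + c) : w' ∈ SOL f g h m := by
  obtain ⟨a, b, ha, hb, hv, hw⟩ := hw
  refine ⟨a, b, ha, hb, ?_, fun t ht => ?_⟩
  · simpa only [h₁] using hv
  · rw [h₁, h₁, h₂, h₂]
    exact ⟨(hw t ht).1, by rw [(hw t ht).2]; ring⟩

/-- The motion which follows `w₁` until `s₁` and has the increments of `w₂` afterwards. -/
def glueMotion {s₀ s₁ s₂ : ℝ} (h₀₁ : s₀ ≤ s₁) (h₁₂ : s₁ ≤ s₂)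
    (p : Motions d s₀ s₁ × Motions d s₁ s₂) : Motions d s₀ s₂ where
  toFun t := p.1 (projIcc s₀ s₁ h₀₁ t) +
    (p.2 (projIcc s₁ s₂ h₁₂ t) - p.2 ⟨s₁, left_mem_Icc.2 h₁₂⟩)

theorem glueMotion_left {s₀ s₁ s₂ : ℝ} (h₀₁ : s₀ ≤ s₁) (h₁₂ : s₁ ≤ s₂)
    (p : Motions d s₀ s₁ × Motions d s₁ s₂) {t : ℝ} (ht : t ∈ Icc s₀ s₁) :
    glueMotion h₀₁ h₁₂ p ⟨t, ht.1, ht.2.trans h₁₂⟩ = p.1 ⟨t, ht⟩ := by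
  simp only [glueMotion, ContinuousMap.coe_mk, projIcc_of_mem h₀₁ ht, projIcc_of_le_left h₁₂ ht.2,
    sub_self, add_zero]

theorem glueMotion_right {s₀ s₁ s₂ : ℝ} (h₀₁ : s₀ ≤ s₁) (h₁₂ : s₁ ≤ s₂)
    (p : Motions d s₀ s₁ × Motions d s₁ s₂) {t : ℝ} (ht : t ∈ Icc s₁ s₂) :
    glueMotion h₀₁ h₁₂ p ⟨t, h₀₁.trans ht.1, ht.2⟩ =
      p.1 ⟨s₁, right_mem_Icc.2 h₀₁⟩ + (p.2 ⟨t, ht⟩ - p.2 ⟨s₁, left_mem_Icc.2 h₁₂⟩) := by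
  simp only [glueMotion, ContinuousMap.coe_mk, projIcc_of_mem h₁₂ ht, projIcc_of_right_le h₀₁ ht.1]

theorem glueMotion_right_fst {s₀ s₁ s₂ : ℝ} (h₀₁ : s₀ ≤ s₁) (h₁₂ : s₁ ≤ s₂)
    {p : Motions d s₀ s₁ × Motions d s₁ s₂}
    (hp : (p.1 ⟨s₁, right_mem_Icc.2 h₀₁⟩).1 = (p.2 ⟨s₁, left_mem_Icc.2 h₁₂⟩).1) {t : ℝ}
    (ht : t ∈ Icc s₁ s₂) :
    (glueMotion h₀₁ h₁₂ p ⟨t, h₀₁.trans ht.1, ht.2⟩).1 = (p.2 ⟨t, ht⟩).1 := by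
  rw [glueMotion_right h₀₁ h₁₂ p ht, Prod.fst_add, Prod.fst_sub, hp, add_sub_cancel]

theorem glueMotion_mem_SOL {s₀ s₁ s₂ : ℝ} (h₀₁ : s₀ ≤ s₁) (h₁₂ : s₁ ≤ s₂)
    {m : ℝ → ProbTorus d} {p : Motions d s₀ s₁ × Motions d s₁ s₂} (h₁ : p.1 ∈ SOL f g h₀₁ m)
    (h₂ : p.2 ∈ SOL f g h₁₂ m)
    (hp : (p.1 ⟨s₁, right_mem_Icc.2 h₀₁⟩).1 = (p.2 ⟨s₁, left_mem_Icc.2 h₁₂⟩).1) :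
    glueMotion h₀₁ h₁₂ p ∈ SOL f g (h₀₁.trans h₁₂) m := by
  refine mem_SOL_of_restrictMotion h₀₁ h₁₂ ?_ ?_
  · convert h₁
    ext1 ⟨t, ht⟩
    exact glueMotion_left h₀₁ h₁₂ p ht
  · refine mem_SOL_of_shift h₁₂ h₂
      ((p.1 ⟨s₁, right_mem_Icc.2 h₀₁⟩).2 - (p.2 ⟨s₁, left_mem_Icc.2 h₁₂⟩).2) ?_ ?_
    · rintro ⟨t, ht⟩
      exact glueMotion_right_fst h₀₁ h₁₂ hp ht
    · rintro ⟨t, ht⟩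
      rw [restrictMotion_apply, glueMotion_right h₀₁ h₁₂ p ht]
      simp only [Prod.snd_add, Prod.snd_sub]
      ring

end Solutions

/-! ### The Bellman operator: continuity and dynamic programming -/

section Bellman

variable {d : ℕ} {U : Type*}
  {f : ℝ → Torus d → ProbTorus d → U → EuclideanSpace ℝ (Fin d)}
  {g : ℝ → Torus d → ProbTorus d → U → ℝ}

/-- The velocity field on the universal cover, extended to all times. -/
def liftedField (f : ℝ → Torus d → ProbTorus d → U → EuclideanSpace ℝ (Fin d))
    (g : ℝ → Torus d → ProbTorus d → U → ℝ) {s r : ℝ} (h : s ≤ r) (m : ℝ → ProbTorus d) (t : ℝ)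
    (W : EuclideanSpace ℝ (Fin d) × ℝ) (u : U) : EuclideanSpace ℝ (Fin d) × ℝ :=
  (f (projIcc s r h t) (toTorus W.1) (m (projIcc s r h t)) u,
    g (projIcc s r h t) (toTorus W.1) (m (projIcc s r h t)) u)

theorem convexHull_liftedField {s r : ℝ} (h : s ≤ r) (m : ℝ → ProbTorus d) {t : ℝ}
    (ht : t ∈ Icc s r) (W : EuclideanSpace ℝ (Fin d) × ℝ) :
    convexHull ℝ (range (liftedField f g h m t W)) = vectogram f g t (toTorus W.1) (m t) := by
  unfold vectogram liftedField
  rw [projIcc_of_mem h ht]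

theorem intervalIntegral_prod {E F : Type*} [NormedAddCommGroup E] [NormedSpace ℝ E]
    [CompleteSpace E] [NormedAddCommGroup F] [NormedSpace ℝ F] [CompleteSpace F] {a b : ℝ}
    {v : ℝ → E × F} (hv : IntervalIntegrable v volume a b) :
    ∫ t in a..b, v t = (∫ t in a..b, (v t).1, ∫ t in a..b, (v t).2) := by
  refine Prod.ext ?_ ?_
  · exact ((ContinuousLinearMap.fst ℝ E F).intervalIntegral_comp_comm hv).symm
  · exact ((ContinuousLinearMap.snd ℝ E F).intervalIntegral_comp_comm hv).symm

/-- Solutions lift to the universal cover. -/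
theorem exists_lift_of_mem_SOL {s r : ℝ} (h : s ≤ r) {m : ℝ → ProbTorus d} {w : Motions d s r}
    (hw : w ∈ SOL f g h m) {y : EuclideanSpace ℝ (Fin d)}
    (hy : toTorus y = (w ⟨s, left_mem_Icc.2 h⟩).1) :
    ∃ v W : ℝ → EuclideanSpace ℝ (Fin d) × ℝ, IntegrableOn v (Icc s r) ∧ Continuous W ∧
      (∀ t ∈ Icc s r, W t = W s + ∫ τ in s..t, v τ) ∧
      (∀ᵐ t, t ∈ Icc s r → v t ∈ convexHull ℝ (range (liftedField f g h m t (W t)))) ∧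
      W s = (y, (w ⟨s, left_mem_Icc.2 h⟩).2) ∧
      ∀ t (ht : t ∈ Icc s r), w ⟨t, ht⟩ = (toTorus (W t).1, (W t).2) := by
  obtain ⟨a, b, ha, hb, hv, hw⟩ := hw
  have hab : IntegrableOn (fun t => (a t, b t)) (Icc s r) := ha.prodMk hb
  have hs := left_mem_Icc.2 h
  set x₀ : EuclideanSpace ℝ (Fin d) × ℝ := (y, (w ⟨s, hs⟩).2) with hx₀
  -- Freezing time outside `[s,r]` makes `W` continuous on the whole line.
  let W : ℝ → EuclideanSpace ℝ (Fin d) × ℝ := fun t =>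
    x₀ + ∫ τ in s..(projIcc s r h t : ℝ), (a τ, b τ)
  have hWt : ∀ t ∈ Icc s r, W t = x₀ + ∫ τ in s..t, (a τ, b τ) := by
    intro t ht
    simp only [W, projIcc_of_mem h ht]
  have hWs : W s = x₀ := by rw [hWt s hs]; simp
  have hWw : ∀ t (ht : t ∈ Icc s r), w ⟨t, ht⟩ = (toTorus (W t).1, (W t).2) := by
    intro t ht
    rw [hWt t ht, intervalIntegral_prod (intervalIntegrable_of_mem hab hs ht)]
    simp only [hx₀, Prod.mk_add_mk, toTorus_add, hy]
    exact Prod.ext (hw t ht).1 (hw t ht).2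
  refine ⟨fun t => (a t, b t), W, hab, ?_, ?_, ?_, hWs, hWw⟩
  · have h1 := intervalIntegral.continuousOn_primitive_interval (a := s) (b := r) (μ := volume)
      (f := fun t => (a t, b t)) (by rwa [uIcc_of_le h])
    rw [uIcc_of_le h] at h1
    exact continuous_const.add (h1.comp_continuous
      (continuous_subtype_val.comp continuous_projIcc) fun t => (projIcc s r h t).2)
  · intro t ht
    rw [hWs, hWt t ht]
  · filter_upwards [hv] with t ht ht'
    rw [convexHull_liftedField h m ht']
    have := ht ht'
    rwa [hWw t ht'] at this

/-- Solutions on the universal cover project to solutions. -/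
theorem exists_mem_SOL_of_lift {s r : ℝ} (h : s ≤ r) {m : ℝ → ProbTorus d}
    {v W : ℝ → EuclideanSpace ℝ (Fin d) × ℝ} {x₀ : EuclideanSpace ℝ (Fin d) × ℝ}
    (hv : IntegrableOn v (Icc s r)) (hW : Continuous W)
    (hWv : ∀ t ∈ Icc s r, W t = x₀ + ∫ τ in s..t, v τ)
    (hmem : ∀ t, v t ∈ convexHull ℝ (range (liftedField f g h m t (W t)))) :
    ∃ w ∈ SOL f g h m, ∀ t (ht : t ∈ Icc s r), w ⟨t, ht⟩ = (toTorus (W t).1, (W t).2) := by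
  have hs := left_mem_Icc.2 h
  have hWs : W s = x₀ := by rw [hWv s hs]; simp
  refine ⟨⟨fun t => (toTorus (W t).1, (W t).2), (continuous_toTorus.comp
    (by fun_prop)).prodMk (by fun_prop)⟩, ⟨fun t => (v t).1, fun t => (v t).2,
    (ContinuousLinearMap.fst ℝ (EuclideanSpace ℝ (Fin d)) ℝ).integrable_comp hv,
    (ContinuousLinearMap.snd ℝ (EuclideanSpace ℝ (Fin d)) ℝ).integrable_comp hv,
    ae_of_all _ fun t ht => ?_, fun t ht => ?_⟩, fun t ht => rfl⟩
  · have := hmem t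
    rwa [convexHull_liftedField h m ht] at this
  · simp only [ContinuousMap.coe_mk]
    rw [hWs, hWv t ht, intervalIntegral_prod (intervalIntegrable_of_mem hv hs ht),
      Prod.fst_add, Prod.snd_add, toTorus_add]
    exact ⟨rfl, rfl⟩

variable [MetricSpace U]

/-- The velocities along the flow `m` are continuous in all variables and Lipschitz continuous in
the state. -/
structure RegularAlong (f : ℝ → Torus d → ProbTorus d → U → EuclideanSpace ℝ (Fin d))
    (g : ℝ → Torus d → ProbTorus d → U → ℝ) (s r : ℝ) (m : ℝ → ProbTorus d) : Prop where
  cont : ContinuousOn (fun p : ℝ × Torus d × U =>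
    (f p.1 p.2.1 (m p.1) p.2.2, g p.1 p.2.1 (m p.1) p.2.2)) (Icc s r ×ˢ univ)
  lip : ∃ L : ℝ, 0 ≤ L ∧ ∀ t ∈ Icc s r, ∀ x x' u,
    ‖f t x (m t) u - f t x' (m t) u‖ ≤ L * dist x x' ∧
    |g t x (m t) u - g t x' (m t) u| ≤ L * dist x x'

theorem RegularAlong.mono {s r s' r' : ℝ} {m : ℝ → ProbTorus d} (hm : RegularAlong f g s' r' m)
    (hs : s' ≤ s) (hr : r ≤ r') : RegularAlong f g s r m := by
  have hsub := Icc_subset_Icc hs hr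
  obtain ⟨L, hL, h⟩ := hm.lip
  exact ⟨hm.cont.mono (prod_mono hsub subset_rfl), L, hL, fun t ht => h t (hsub ht)⟩

theorem continuous_liftedField {s r : ℝ} (h : s ≤ r) {m : ℝ → ProbTorus d}
    (hm : RegularAlong f g s r m) :
    Continuous fun p : ℝ × (EuclideanSpace ℝ (Fin d) × ℝ) × U =>
      liftedField f g h m p.1 p.2.1 p.2.2 := by
  have h1 : Continuous fun p : ℝ × (EuclideanSpace ℝ (Fin d) × ℝ) × U =>
      ((projIcc s r h p.1 : ℝ), toTorus p.2.1.1, p.2.2) := by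
    refine (continuous_subtype_val.comp (continuous_projIcc.comp continuous_fst)).prodMk ?_
    exact (continuous_toTorus.comp (by fun_prop)).prodMk (by fun_prop)
  exact hm.cont.comp_continuous h1 fun p => ⟨(projIcc s r h p.1).2, trivial⟩

theorem exists_lipschitz_liftedField {s r : ℝ} (h : s ≤ r) {m : ℝ → ProbTorus d}
    (hm : RegularAlong f g s r m) : ∃ L : ℝ, 0 ≤ L ∧ ∀ t W W' u,
      ‖liftedField f g h m t W u - liftedField f g h m t W' u‖ ≤ L * ‖W - W'‖ := by
  obtain ⟨L, hL, hl⟩ := hm.lip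
  refine ⟨L, hL, fun t W W' u => ?_⟩
  have h1 := hl _ (projIcc s r h t).2 (toTorus W.1) (toTorus W'.1) u
  have h2 : L * dist (toTorus W.1) (toTorus W'.1) ≤ L * ‖W - W'‖ := by
    gcongr
    exact (dist_toTorus_le _ _).trans (norm_fst_le (W - W'))
  rw [Prod.norm_def]
  exact max_le (h1.1.trans h2) (h1.2.trans h2)

/-- A constant control already gives a Lipschitz equation. The set in `bellman` is thus nonempty, as
needed for its supremum to be approached. -/
theorem Sol_nonempty [Nonempty U] {s r : ℝ} (h : s ≤ r) {m : ℝ → ProbTorus d}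
    (hm : RegularAlong f g s r m) (y : Torus d) : (Sol f g h y m).Nonempty := by
  obtain ⟨u⟩ := ‹Nonempty U›
  obtain ⟨y₀, hy₀, -⟩ := exists_toTorus_eq y
  obtain ⟨L, hL, hl⟩ := exists_lipschitz_liftedField h hm
  have hc := continuous_liftedField h hm
  have hF : ∀ X : ℝ → EuclideanSpace ℝ (Fin d) × ℝ, Continuous X →
      Continuous fun t => liftedField f g h m t (X t) u := fun X hX =>
    hc.comp (by fun_prop : Continuous fun t => (t, X t, u))
  have hint : ∀ X : ℝ → EuclideanSpace ℝ (Fin d) × ℝ, Continuous X →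
      IntegrableOn (fun t => liftedField f g h m t (X t) u) (Icc s r) := fun X hX =>
    (hF X hX).integrableOn_Icc
  have hprim : Continuous fun t : ℝ => (0 : EuclideanSpace ℝ (Fin d) × ℝ)
      - ((y₀, (0 : ℝ)) + ∫ τ in s..t, liftedField f g h m τ 0 u) :=
    continuous_const.sub (continuous_const.add
      (intervalIntegral.continuous_primitive (fun a b => (hF _ continuous_const).intervalIntegrable
        a b) s))
  obtain ⟨η, hη⟩ := (isCompact_Icc (a := s) (b := r)).exists_bound_of_continuousOn
    hprim.continuousOn
  obtain ⟨W, hWc, hW, -⟩ := exists_integral_solution h hL (fun t x => liftedField f g h m t x u)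
    (fun t x x' => hl t x x' u) hint (fun _ => 0) continuous_const (y₀, 0) η hη
  obtain ⟨w, hw, hwW⟩ := exists_mem_SOL_of_lift h (hint W hWc) hWc hW
    fun t => subset_convexHull ℝ _ (mem_range_self _)
  refine ⟨w, hw, ?_⟩
  rw [hwW, hW s (left_mem_Icc.2 h)]
  simpa using hy₀

/-- Solutions with nearby initial points can be chosen close to each other. -/
theorem exists_mem_Sol_near [CompactSpace U] [Nonempty U] {s r : ℝ} (h : s ≤ r)
    {m : ℝ → ProbTorus d} (hm : RegularAlong f g s r m) :
    ∃ K : ℝ, 0 ≤ K ∧ ∀ w ∈ SOL f g h m, ∀ (y : Torus d) (ε : ℝ), 0 < ε → ∃ w' ∈ Sol f g h y m,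
      (w' ⟨s, left_mem_Icc.2 h⟩).2 = (w ⟨s, left_mem_Icc.2 h⟩).2 ∧
      dist (w' ⟨r, right_mem_Icc.2 h⟩) (w ⟨r, right_mem_Icc.2 h⟩)
        ≤ K * (dist y (w ⟨s, left_mem_Icc.2 h⟩).1 + ε) := by
  obtain ⟨L, hL, hl⟩ := exists_lipschitz_liftedField h hm
  have hc := continuous_liftedField h hm
  have hs := left_mem_Icc.2 h
  have hr := right_mem_Icc.2 h
  have hrs : 0 ≤ r - s := by linarith
  -- The exponential and the factor `2` come from `exists_solution_near`, `√d` from lifting the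
  -- displacement of the initial point, and `r - s` from integrating the velocity error.
  refine ⟨Real.exp ((2 * L + 1) * (r - s)) * (2 * (√d + (r - s))), by positivity, ?_⟩
  intro w hw y ε hε
  obtain ⟨y₀, hy₀, -⟩ := exists_toTorus_eq (w ⟨s, hs⟩).1
  obtain ⟨e, he, hen⟩ := exists_toTorus_eq (y - (w ⟨s, hs⟩).1)
  obtain ⟨v, W, hv, hWc, hW, hmem, hWs, hWw⟩ := exists_lift_of_mem_SOL h hw hy₀
  obtain ⟨v', W', hv', hWc', hW', hmem', hn⟩ := exists_solution_near h hL (liftedField f g h m) hc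
    hl v hv W hWc hW hmem (y₀ + e, (w ⟨s, hs⟩).2) hε
  obtain ⟨w', hw', hwW'⟩ := exists_mem_SOL_of_lift h hv' hWc' hW' hmem'
  have hWs' : W' s = (y₀ + e, (w ⟨s, hs⟩).2) := by rw [hW' s hs]; simp
  refine ⟨w', ⟨hw', ?_⟩, ?_, ?_⟩
  · rw [hwW', hWs', toTorus_add, hy₀, he]; simp
  · rw [hwW', hWs']
  · have h1 : dist (w' ⟨r, hr⟩) (w ⟨r, hr⟩) ≤ ‖W r - W' r‖ := by
      rw [hwW', hWw, Prod.dist_eq, norm_sub_rev]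
      exact max_le ((dist_toTorus_le _ _).trans (norm_fst_le (W' r - W r)))
        ((Real.dist_eq _ _).trans_le (norm_snd_le (W' r - W r)))
    refine h1.trans ((hn r hr).trans ?_)
    have h2 : ‖W s - (y₀ + e, (w ⟨s, hs⟩).2)‖ = ‖e‖ := by
      rw [hWs, Prod.mk_sub_mk]; simp [Prod.norm_def]
    rw [h2, mul_assoc]
    gcongr ?_ * ?_
    rw [← dist_eq_norm] at hen
    have := mul_nonneg (Real.sqrt_nonneg d) hε.le
    have := mul_nonneg hrs (dist_nonneg (x := y) (y := (w ⟨s, hs⟩).1))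
    nlinarith

/-- The velocities are bounded over the compact `[s,r] × 𝕋^d × U`, and a ball containing them
contains their convex hulls. This keeps the supremum in `bellman` finite. -/
theorem exists_bound_of_mem_SOL [CompactSpace U] {s r : ℝ} (h : s ≤ r) {m : ℝ → ProbTorus d}
    (hm : RegularAlong f g s r m) : ∃ C : ℝ, ∀ w ∈ SOL f g h m,
      |(w ⟨r, right_mem_Icc.2 h⟩).2 - (w ⟨s, left_mem_Icc.2 h⟩).2| ≤ C := by
  obtain ⟨C, hC⟩ := (isCompact_Icc.prod isCompact_univ).exists_bound_of_continuousOn hm.cont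
  refine ⟨C * |r - s|, ?_⟩
  rintro w ⟨a, b, ha, hb, hv, hw⟩
  rw [(hw r (right_mem_Icc.2 h)).2, add_sub_cancel_left, ← Real.norm_eq_abs]
  refine intervalIntegral.norm_integral_le_of_norm_le_const_ae ?_
  filter_upwards [hv] with t ht ht'
  rw [uIoc_of_le h] at ht'
  have htm := Ioc_subset_Icc_self ht'
  have hsub : vectogram f g t (w ⟨t, htm⟩).1 (m t) ⊆ Metric.closedBall 0 C := by
    refine convexHull_min ?_ (convex_closedBall 0 C)
    rintro _ ⟨u, rfl⟩
    rw [mem_closedBall_zero_iff]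
    exact hC (t, _, u) ⟨htm, trivial⟩
  exact (norm_snd_le _).trans (mem_closedBall_zero_iff.1 (hsub (ht htm)))

theorem bddAbove_bellman [CompactSpace U] {s r : ℝ} (h : s ≤ r) {m : ℝ → ProbTorus d}
    (hm : RegularAlong f g s r m) (ψ : C(Torus d, ℝ)) (y : Torus d) :
    BddAbove {c : ℝ | ∃ w ∈ Sol f g h y m, c = ψ (w ⟨r, right_mem_Icc.2 h⟩).1
      + (w ⟨r, right_mem_Icc.2 h⟩).2 - (w ⟨s, left_mem_Icc.2 h⟩).2} := by
  obtain ⟨C, hC⟩ := exists_bound_of_mem_SOL h hm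
  refine ⟨‖ψ‖ + C, ?_⟩
  rintro _ ⟨w, hw, rfl⟩
  have h1 := (abs_le.1 (hC w hw.1)).2
  have h2 := (le_abs_self _).trans (ψ.norm_coe_le_norm (w ⟨r, right_mem_Icc.2 h⟩).1)
  linarith

theorem le_bellman [CompactSpace U] {s r : ℝ} (h : s ≤ r) {m : ℝ → ProbTorus d}
    (hm : RegularAlong f g s r m) (ψ : C(Torus d, ℝ)) {w : Motions d s r}
    (hw : w ∈ SOL f g h m) :
    ψ (w ⟨r, right_mem_Icc.2 h⟩).1 + (w ⟨r, right_mem_Icc.2 h⟩).2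
      ≤ bellman f g h m ψ (w ⟨s, left_mem_Icc.2 h⟩).1 + (w ⟨s, left_mem_Icc.2 h⟩).2 := by
  rw [← sub_le_iff_le_add]
  exact le_csSup (bddAbove_bellman h hm ψ _) ⟨w, ⟨hw, rfl⟩, rfl⟩

theorem exists_lt_of_lt_bellman [Nonempty U] {s r : ℝ} (h : s ≤ r) {m : ℝ → ProbTorus d}
    (hm : RegularAlong f g s r m) (ψ : C(Torus d, ℝ)) (y : Torus d) {c : ℝ}
    (hc : c < bellman f g h m ψ y) :
    ∃ w ∈ Sol f g h y m, c < ψ (w ⟨r, right_mem_Icc.2 h⟩).1 + (w ⟨r, right_mem_Icc.2 h⟩).2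
      - (w ⟨s, left_mem_Icc.2 h⟩).2 := by
  obtain ⟨w₀, hw₀⟩ := Sol_nonempty h hm y
  obtain ⟨_, ⟨w, hw, rfl⟩, hlt⟩ := exists_lt_of_lt_csSup (by exact ⟨_, w₀, hw₀, rfl⟩) hc
  exact ⟨w, hw, hlt⟩

/-- A nearly optimal motion from `y` is followed by a nearby one from `y'`; the losses from
near-optimality, from `ψ` and from `z` are each at most `ε / 3`. -/
theorem continuous_bellman [CompactSpace U] [Nonempty U] {s r : ℝ} (h : s ≤ r)
    {m : ℝ → ProbTorus d} (hm : RegularAlong f g s r m) (ψ : C(Torus d, ℝ)) :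
    Continuous (bellman f g h m ψ) := by
  obtain ⟨K, hK, hnear⟩ := exists_mem_Sol_near h hm
  have key : ∀ ε > 0, ∃ δ > 0, ∀ y y' : Torus d, dist y' y < δ →
      bellman f g h m ψ y ≤ bellman f g h m ψ y' + ε := by
    intro ε hε
    obtain ⟨η, hη, hψ⟩ := Metric.uniformContinuous_iff.1
      (CompactSpace.uniformContinuous_of_continuous ψ.continuous) (ε / 3) (by positivity)
    set ρ := min η (ε / 3) with hρ
    have hρ0 : 0 < ρ := lt_min hη (by positivity)
    -- `δ` is used both as the distance of the initial points and as the error in `hnear`, so the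
    -- endpoints differ by at most `2Kδ < ρ`.
    set δ := ρ / (2 * (K + 1)) with hδ
    have hδ0 : 0 < δ := by positivity
    refine ⟨δ, hδ0, fun y y' hyy => ?_⟩
    obtain ⟨w, hw, hwc⟩ := exists_lt_of_lt_bellman h hm ψ y
      (c := bellman f g h m ψ y - ε / 3) (by linarith)
    obtain ⟨w', hw', hz, hd⟩ := hnear w hw.1 y' δ hδ0
    have hle := le_bellman h hm ψ hw'.1
    rw [hw'.2] at hle
    rw [hw.2] at hd
    have hdρ : dist (w' ⟨r, right_mem_Icc.2 h⟩) (w ⟨r, right_mem_Icc.2 h⟩) < ρ := by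
      refine hd.trans_lt ?_
      calc _ ≤ K * (δ + δ) := by gcongr
        _ = K / (K + 1) * ρ := by rw [hδ]; field_simp; ring
        _ < 1 * ρ := by gcongr; rw [div_lt_one (by positivity)]; linarith
        _ = ρ := one_mul ρ
    rw [Prod.dist_eq, max_lt_iff, Real.dist_eq] at hdρ
    have h1 := hψ (hdρ.1.trans_le (min_le_left _ _))
    have h2 := hdρ.2.trans_le (min_le_right _ _)
    rw [Real.dist_eq] at h1
    linarith [(abs_lt.1 h1).1, (abs_lt.1 h2).1]
  refine Metric.continuous_iff.2 fun y ε hε => ?_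
  obtain ⟨δ, hδ, hk⟩ := key (ε / 2) (by positivity)
  refine ⟨δ, hδ, fun y' hy' => ?_⟩
  rw [Real.dist_eq, abs_lt]
  have h1 := hk y y' hy'
  have h2 := hk y' y (by rwa [dist_comm])
  constructor <;> linarith

/-- The dynamic programming principle. -/
theorem bellman_comp [CompactSpace U] [Nonempty U] {s₀ s₁ s₂ : ℝ} (h₀₁ : s₀ ≤ s₁) (h₁₂ : s₁ ≤ s₂)
    {m : ℝ → ProbTorus d} (hm : RegularAlong f g s₀ s₂ m) (ψ₁ ψ₂ : C(Torus d, ℝ))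
    (hψ : ∀ y, ψ₁ y = bellman f g h₁₂ m ψ₂ y) (y : Torus d) :
    bellman f g (h₀₁.trans h₁₂) m ψ₂ y = bellman f g h₀₁ m ψ₁ y := by
  have hm₁ := hm.mono le_rfl h₁₂
  have hm₂ := hm.mono h₀₁ le_rfl
  -- For `≤`, a motion is cut at `s₁` and both pieces are estimated; for `≥`, two `ε / 2`-optimal
  -- motions are glued at `s₁`.
  refine le_antisymm (le_of_forall_lt fun c hc => ?_) (le_of_forall_pos_le_add fun ε hε => ?_)
  · obtain ⟨w, hw, hwc⟩ := exists_lt_of_lt_bellman _ hm ψ₂ y hc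
    have h1 := le_bellman h₀₁ hm₁ ψ₁ (restrictMotion_mem_SOL le_rfl h₀₁ h₁₂ hw.1)
    have h2 := le_bellman h₁₂ hm₂ ψ₂ (restrictMotion_mem_SOL h₀₁ h₁₂ le_rfl hw.1)
    rw [← hψ] at h2
    simp only [restrictMotion_apply, hw.2] at h1 h2
    linarith
  · obtain ⟨w₁, hw₁, hc₁⟩ := exists_lt_of_lt_bellman h₀₁ hm₁ ψ₁ y
      (c := bellman f g h₀₁ m ψ₁ y - ε / 2) (by linarith)
    obtain ⟨w₂, hw₂, hc₂⟩ := exists_lt_of_lt_bellman h₁₂ hm₂ ψ₂ (w₁ ⟨s₁, right_mem_Icc.2 h₀₁⟩).1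
      (c := ψ₁ (w₁ ⟨s₁, right_mem_Icc.2 h₀₁⟩).1 - ε / 2) (by rw [hψ]; linarith)
    have hp := hw₂.2.symm
    have h1 := le_bellman _ hm ψ₂ (glueMotion_mem_SOL h₀₁ h₁₂ (p := (w₁, w₂)) hw₁.1 hw₂.1 hp)
    have hr := glueMotion_right h₀₁ h₁₂ (w₁, w₂) (right_mem_Icc.2 h₁₂)
    have hr₁ := glueMotion_right_fst h₀₁ h₁₂ (p := (w₁, w₂)) hp (right_mem_Icc.2 h₁₂)
    have hl := glueMotion_left h₀₁ h₁₂ (w₁, w₂) (left_mem_Icc.2 h₀₁)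
    rw [hr₁, hr, hl, hw₁.2] at h1
    simp only [Prod.snd_add, Prod.snd_sub] at h1
    linarith

end Bellman

/-! ### Mean field flows and the semigroup property -/

section Flows

variable {d : ℕ} {U : Type*}
  {f : ℝ → Torus d → ProbTorus d → U → EuclideanSpace ℝ (Fin d)}
  {g : ℝ → Torus d → ProbTorus d → U → ℝ}

theorem W1_nonneg {X : Type*} [MetricSpace X] [MeasurableSpace X] (μ ν : ProbabilityMeasure X) :
    0 ≤ W1 μ ν := by
  refine Real.sInf_nonneg ?_
  rintro _ ⟨π, -, -, rfl⟩
  exact integral_nonneg fun _ => dist_nonneg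

theorem W1_self (μ : ProbTorus d) : W1 μ μ = 0 := by
  refine le_antisymm ?_ (W1_nonneg μ μ)
  have hp : Measurable fun x : Torus d => (x, x) := measurable_id.prodMk measurable_id
  refine (W1_le (π := (μ : Measure (Torus d)).map fun x => (x, x)) ?_ ?_).trans_eq ?_
  · rw [Measure.map_map measurable_fst hp]; exact Measure.map_id
  · rw [Measure.map_map measurable_snd hp]; exact Measure.map_id
  · rw [integral_map hp.aemeasurable continuous_dist.measurable.aestronglyMeasurable]
    simp

theorem measurable_eval {s r : ℝ} (t : Icc s r) : Measurable fun w : Motions d s r => w t :=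
  (continuous_eval_const t).measurable

theorem proj_eq_of_map_eq {Ω : Type*} [MeasurableSpace Ω]
    {ν : ProbabilityMeasure (Torus d × ℝ)} {μ : Measure Ω} {X : Ω → Torus d × ℝ}
    (hX : Measurable X) (hν : (ν : Measure (Torus d × ℝ)) = μ.map X) :
    (proj ν : Measure (Torus d)) = μ.map fun ω => (X ω).1 := by
  have : (proj ν : Measure (Torus d)) = (ν : Measure (Torus d × ℝ)).map Prod.fst := rfl
  rw [this, hν, Measure.map_map measurable_fst hX]
  rfl

theorem bracket_eq_of_map_eq {Ω : Type*} [MeasurableSpace Ω] (φ : C(Torus d, ℝ))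
    {ν : ProbabilityMeasure (Torus d × ℝ)} {μ : Measure Ω} {X : Ω → Torus d × ℝ}
    (hX : Measurable X) (hν : (ν : Measure (Torus d × ℝ)) = μ.map X) :
    bracket φ ν = ∫ ω, (φ (X ω).1 + (X ω).2) ∂μ := by
  have hc : Continuous fun q : Torus d × ℝ => φ q.1 + q.2 := by fun_prop
  rw [bracket, hν, integral_map hX.aemeasurable hc.measurable.aestronglyMeasurable]

theorem integrable_payoff {s r : ℝ} {χ : Measure (Motions d s r)} [IsFiniteMeasure χ]
    (hχ : HasFiniteFirstMoment χ) (φ : C(Torus d, ℝ)) (t : Icc s r) :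
    Integrable (fun w : Motions d s r => φ (w t).1 + (w t).2) χ := by
  refine hχ.integrable (by fun_prop) 0 ‖φ‖ fun w => (abs_add_le _ _).trans ?_
  refine add_le_add (φ.norm_coe_le_norm _) ?_
  calc |(w t).2| = dist (w t).2 ((0 : Motions d s r) t).2 := by simp
    _ ≤ dist (w t) ((0 : Motions d s r) t) := by rw [Prod.dist_eq]; exact le_max_right _ _
    _ ≤ _ := ContinuousMap.dist_apply_le_dist t

/-- The flow is the law of a random continuous curve, hence continuous for `W1`; inserting it into
`f` and `g` preserves joint continuity. For the Lipschitz bound both states see the same measure, so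
the `W1` term vanishes. -/
theorem regularAlong_of_solvesMFDI [MetricSpace U] {T : ℝ} (hfg : StandingAssumptions T f g)
    {s r : ℝ} (h : s ≤ r) (hs : 0 ≤ s) (hr : r ≤ T)
    {ν : ℝ → ProbabilityMeasure (Torus d × ℝ)} (hν : SolvesMFDI f g h ν) :
    RegularAlong f g s r fun t => proj (ν t) := by
  obtain ⟨χ, -, hχ, -⟩ := hν
  have hsub : Icc s r ⊆ Icc 0 T := Icc_subset_Icc hs hr
  have hW : ∀ t ∈ Icc s r,
      Tendsto (fun t' => W1 (proj (ν t')) (proj (ν t))) (𝓝[Icc s r] t) (𝓝 0) := by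
    intro t ht
    rw [tendsto_nhdsWithin_iff_subtype ht]
    exact tendsto_W1_of_map (χ : Measure (Motions d s r)) (fun t w => (w t).1)
      (fun t => measurable_fst.comp (measurable_eval t)) (fun w => by fun_prop)
      (fun t : Icc s r => proj (ν t))
      (fun t => proj_eq_of_map_eq (measurable_eval t) (hχ t t.2)) ⟨t, ht⟩
  have hcont : ∀ {V : Type} [NormedAddCommGroup V] (k : ℝ → Torus d → ProbTorus d → U → V),
      JointlyContinuous T k → ContinuousOn
        (fun p : ℝ × Torus d × U => k p.1 p.2.1 (proj (ν p.1)) p.2.2) (Icc s r ×ˢ univ) := by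
    rintro V _ k hk ⟨t, x, u⟩ ⟨ht, -⟩
    refine Metric.tendsto_nhds.2 fun ε hε => ?_
    obtain ⟨δ, hδ, hkδ⟩ := hk t (hsub ht) x (proj (ν t)) u ε hε
    have hfst : Tendsto (Prod.fst : ℝ × Torus d × U → ℝ) (𝓝[Icc s r ×ˢ univ] (t, x, u))
        (𝓝[Icc s r] t) :=
      tendsto_nhdsWithin_of_tendsto_nhds_of_eventually_within _
        (continuous_fst.continuousWithinAt) (eventually_mem_nhdsWithin.mono fun p hp => hp.1)
    filter_upwards [eventually_mem_nhdsWithin, ((hW t ht).comp hfst).eventually_lt_const hδ,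
      mem_nhdsWithin_of_mem_nhds (Metric.ball_mem_nhds (t, x, u) hδ)] with p hp h1 h2
    rw [Metric.mem_ball, Prod.dist_eq, Prod.dist_eq, max_lt_iff, max_lt_iff] at h2
    rw [dist_eq_norm]
    exact hkδ _ (hsub hp.1) _ _ _ h2.1 h2.2.1 h1 h2.2.2
  refine ⟨(hcont f hfg.continuous_f).prodMk (hcont g hfg.continuous_g), ?_⟩
  obtain ⟨L, hL⟩ := hfg.lipschitz
  refine ⟨|L|, abs_nonneg L, fun t ht x x' u => ?_⟩
  have h1 := hL t (hsub ht) x x' (proj (ν t)) (proj (ν t)) u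
  rw [W1_self, add_zero] at h1
  have h2 : L * dist x x' ≤ |L| * dist x x' := by gcongr; exact le_abs_self L
  exact ⟨h1.1.trans h2, h1.2.trans h2⟩

/-- With no controls the vectogram is empty, and the inclusion would fail on an interval of positive
length. -/
theorem nonempty_of_solvesMFDI {s r : ℝ} (h : s < r) {ν : ℝ → ProbabilityMeasure (Torus d × ℝ)}
    (hν : SolvesMFDI f g h.le ν) : Nonempty U := by
  obtain ⟨χ, -, -, hχ⟩ := hν
  obtain ⟨w, a, b, -, -, hv, -⟩ := hχ.exists
  by_contra hU
  rw [not_nonempty_iff] at hU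
  have h0 : ∀ᵐ t : ℝ, ¬ t ∈ Icc s r := by
    filter_upwards [hv] with t ht ht'
    have h1 := ht ht'
    rw [vectogram, range_eq_empty, convexHull_empty] at h1
    exact h1
  have h1 : volume (Icc s r) = 0 := measure_eq_zero_iff_ae_notMem.2 h0
  rw [Real.volume_Icc] at h1
  exact absurd (ENNReal.ofReal_eq_zero.1 h1) (by linarith)

theorem lipschitzWith_restrictMotion {s r s' r' : ℝ} (hs : s' ≤ s) (hr : r ≤ r') :
    LipschitzWith 1 (restrictMotion (d := d) hs hr) := by
  refine LipschitzWith.of_dist_le_mul fun w w' => ?_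
  rw [ContinuousMap.dist_le (by positivity)]
  intro t
  rw [NNReal.coe_one, one_mul]
  exact ContinuousMap.dist_apply_le_dist (f := w) (g := w') _

theorem lipschitzWith_glueMotion {s₀ s₁ s₂ : ℝ} (h₀₁ : s₀ ≤ s₁) (h₁₂ : s₁ ≤ s₂) :
    LipschitzWith 3 (glueMotion (d := d) h₀₁ h₁₂) := by
  refine LipschitzWith.of_dist_le_mul fun p p' => ?_
  rw [ContinuousMap.dist_le (by positivity)]
  intro t
  have h1 : dist p.1 p'.1 ≤ dist p p' := le_max_left _ _
  have h2 : dist p.2 p'.2 ≤ dist p p' := le_max_right _ _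
  have h3 := fun t => (ContinuousMap.dist_apply_le_dist (f := p.1) (g := p'.1) t).trans h1
  have h4 := fun t => (ContinuousMap.dist_apply_le_dist (f := p.2) (g := p'.2) t).trans h2
  refine (dist_add_add_le _ _ _ _).trans ((add_le_add (h3 _) ((dist_sub_sub_le _ _ _ _).trans
    (add_le_add (h4 _) (h4 _)))).trans ?_)
  rw [NNReal.coe_ofNat]
  linarith

theorem SolvesMFDI.restrict {s r s' r' : ℝ} (hs : s' ≤ s) (h : s ≤ r) (hr : r ≤ r')
    {ν : ℝ → ProbabilityMeasure (Torus d × ℝ)}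
    (hν : SolvesMFDI f g (hs.trans (h.trans hr)) ν) : SolvesMFDI f g h ν := by
  obtain ⟨χ, hχ, hχν, hχS⟩ := hν
  have hl := lipschitzWith_restrictMotion (d := d) hs hr
  refine ⟨χ.map hl.continuous.measurable.aemeasurable, ?_, fun t ht => ?_, ?_⟩
  · exact hχ.map hl
  · rw [ProbabilityMeasure.toMeasure_map, Measure.map_map (measurable_eval _)
      hl.continuous.measurable]
    exact hχν t (Icc_subset_Icc hs hr ht)
  · rw [ProbabilityMeasure.toMeasure_map]
    refine ae_map_of_ae_comp _ hl.continuous ?_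
    filter_upwards [hχS] with w hw
    exact restrictMotion_mem_SOL hs h hr hw

/-- The mean payoff along a flow does not exceed the one predicted by the Bellman operator. -/
theorem bracket_le_bracket_bellman [MetricSpace U] [CompactSpace U] {s r : ℝ} (h : s ≤ r)
    {ν : ℝ → ProbabilityMeasure (Torus d × ℝ)} (hν : SolvesMFDI f g h ν)
    (hm : RegularAlong f g s r fun t => proj (ν t)) (φ ψ : C(Torus d, ℝ))
    (hφ : ∀ y, φ y = bellman f g h (fun t => proj (ν t)) ψ y) :
    bracket ψ (ν r) ≤ bracket φ (ν s) := by
  obtain ⟨χ, hχ, hχν, hχS⟩ := hν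
  rw [bracket_eq_of_map_eq ψ (measurable_eval _) (hχν r (right_mem_Icc.2 h)),
    bracket_eq_of_map_eq φ (measurable_eval _) (hχν s (left_mem_Icc.2 h))]
  refine integral_mono_ae (integrable_payoff hχ _ _) (integrable_payoff hχ _ _) ?_
  filter_upwards [hχS] with w hw
  simp only [hφ]
  exact le_bellman h hm ψ hw

/-- With `φ = p.2` and `ψ₂ = q.2`, the chain `[φ, ν(s₀)] ≤ [ψ₂, ν(s₂)] ≤ [ψ₁, ν(s₁)] ≤ [φ, ν(s₀)]`
closes up: the first step is the assumption, the others hold for every solution. Both required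
inequalities are read off from it. -/
theorem Psi_subset_multiComp [MetricSpace U] [CompactSpace U] {T : ℝ}
    (hfg : StandingAssumptions T f g) {s₀ s₁ s₂ : ℝ} (h₀ : 0 ≤ s₀) (h₀₁ : s₀ < s₁) (h₁₂ : s₁ < s₂)
    (h₂ : s₂ ≤ T) (p : ProbTorus d × C(Torus d, ℝ)) :
    Psi f g (h₀₁.trans h₁₂).le p ⊆ multiComp (Psi f g h₁₂.le) (Psi f g h₀₁.le) p := by
  rintro q ⟨ν, hν, hp, hq, hφ, hb⟩
  have := nonempty_of_solvesMFDI (h₀₁.trans h₁₂) hν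
  have hm := regularAlong_of_solvesMFDI hfg _ h₀ h₂ hν
  have hm₁ := hm.mono le_rfl h₁₂.le
  have hm₂ := hm.mono h₀₁.le le_rfl
  have hν₁ := hν.restrict le_rfl h₀₁.le h₁₂.le
  have hν₂ := hν.restrict h₀₁.le h₁₂.le le_rfl
  let ψ₁ : C(Torus d, ℝ) := ⟨_, continuous_bellman h₁₂.le hm₂ q.2⟩
  have hψ₁ : ∀ y, ψ₁ y = bellman f g h₁₂.le (fun t => proj (ν t)) q.2 y := fun _ => rfl
  have hφ₁ : ∀ y, p.2 y = bellman f g h₀₁.le (fun t => proj (ν t)) ψ₁ y := fun y => by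
    rw [hφ y, bellman_comp h₀₁.le h₁₂.le hm ψ₁ q.2 hψ₁]
  have hb₁ := bracket_le_bracket_bellman _ hν₁ hm₁ _ _ hφ₁
  have hb₂ := bracket_le_bracket_bellman _ hν₂ hm₂ _ _ hψ₁
  exact mem_iUnion₂.2 ⟨(proj (ν s₁), ψ₁), ⟨ν, hν₁, hp, rfl, hφ₁, hb.trans hb₂⟩,
    ν, hν₂, rfl, hq, hψ₁, hb₁.trans hb⟩

/-- Solutions of the mean field type differential inclusion on adjacent intervals, with the same
distribution of the state at the common time, can be concatenated. -/
theorem exists_concatenation {s₀ s₁ s₂ : ℝ} (h₀₁ : s₀ ≤ s₁) (h₁₂ : s₁ ≤ s₂)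
    {ν₁ ν₂ : ℝ → ProbabilityMeasure (Torus d × ℝ)} (hν₁ : SolvesMFDI f g h₀₁ ν₁)
    (hν₂ : SolvesMFDI f g h₁₂ ν₂) (hm : proj (ν₁ s₁) = proj (ν₂ s₁)) :
    ∃ ν, SolvesMFDI f g (h₀₁.trans h₁₂) ν ∧ (∀ t ∈ Icc s₀ s₁, ν t = ν₁ t) ∧
      (∀ t ∈ Icc s₁ s₂, proj (ν t) = proj (ν₂ t)) ∧
      ∀ ψ₁ ψ₂ : C(Torus d, ℝ), bracket ψ₂ (ν s₂) =
        bracket ψ₁ (ν₁ s₁) + (bracket ψ₂ (ν₂ s₂) - bracket ψ₁ (ν₂ s₁)) := by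
  obtain ⟨χ₁, hχ₁, hχν₁, hχS₁⟩ := hν₁
  obtain ⟨χ₂, hχ₂, hχν₂, hχS₂⟩ := hν₂
  have hr₁ := right_mem_Icc.2 h₀₁
  have hl₂ := left_mem_Icc.2 h₁₂
  have hr₂ := right_mem_Icc.2 h₁₂
  have hm' : (χ₁ : Measure (Motions d s₀ s₁)).map (fun w => (w ⟨s₁, hr₁⟩).1) =
      (χ₂ : Measure (Motions d s₁ s₂)).map fun w => (w ⟨s₁, hl₂⟩).1 := by
    rw [← proj_eq_of_map_eq (measurable_eval _) (hχν₁ s₁ hr₁), hm,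
      proj_eq_of_map_eq (measurable_eval _) (hχν₂ s₁ hl₂)]
  obtain ⟨γ, hγ₁, hγ₂, hγ⟩ := exists_gluing _ _ (measurable_fst.comp (measurable_eval _))
    (measurable_fst.comp (measurable_eval _)) hm'
  have hl := lipschitzWith_glueMotion (d := d) h₀₁ h₁₂
  have hgm := hl.continuous.measurable
  set χ := γ.map hgm.aemeasurable with hχ
  have hχm : (χ : Measure (Motions d s₀ s₂)) = (γ : Measure (Motions d s₀ s₁ × Motions d s₁ s₂)).map (glueMotion h₀₁ h₁₂) := rfl
  let ν : ℝ → ProbabilityMeasure (Torus d × ℝ) := fun t =>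
    χ.map (measurable_eval (projIcc s₀ s₂ (h₀₁.trans h₁₂) t)).aemeasurable
  have hνχ : ∀ t (ht : t ∈ Icc s₀ s₂), (ν t : Measure (Torus d × ℝ)) =
      (χ : Measure (Motions d s₀ s₂)).map fun w => w ⟨t, ht⟩ := by
    intro t ht
    simp only [ν, projIcc_of_mem _ ht]
    rfl
  have hνγ : ∀ t (ht : t ∈ Icc s₀ s₂), (ν t : Measure (Torus d × ℝ)) =
      (γ : Measure (Motions d s₀ s₁ × Motions d s₁ s₂)).map fun p => glueMotion h₀₁ h₁₂ p ⟨t, ht⟩ := by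
    intro t ht
    rw [hνχ t ht, hχm, Measure.map_map (measurable_eval _) hgm]
    rfl
  have hνγ₁ : ∀ t (ht : t ∈ Icc s₀ s₁), (ν₁ t : Measure (Torus d × ℝ)) =
      (γ : Measure (Motions d s₀ s₁ × Motions d s₁ s₂)).map fun p => p.1 ⟨t, ht⟩ := by
    intro t ht
    rw [hχν₁ t ht, ← hγ₁, Measure.map_map (measurable_eval _) measurable_fst]
    rfl
  have hνγ₂ : ∀ t (ht : t ∈ Icc s₁ s₂), (ν₂ t : Measure (Torus d × ℝ)) =
      (γ : Measure (Motions d s₀ s₁ × Motions d s₁ s₂)).map fun p => p.2 ⟨t, ht⟩ := by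
    intro t ht
    rw [hχν₂ t ht, ← hγ₂, Measure.map_map (measurable_eval _) measurable_snd]
    rfl
  have hm₁ : ∀ t : Icc s₀ s₁, Measurable fun p : Motions d s₀ s₁ × Motions d s₁ s₂ => p.1 t :=
    fun t => (measurable_eval t).comp measurable_fst
  have hm₂ : ∀ t : Icc s₁ s₂, Measurable fun p : Motions d s₀ s₁ × Motions d s₁ s₂ => p.2 t :=
    fun t => (measurable_eval t).comp measurable_snd
  have hmg : ∀ t : Icc s₀ s₂, Measurable fun p : Motions d s₀ s₁ × Motions d s₁ s₂ =>
      glueMotion h₀₁ h₁₂ p t := fun t => (measurable_eval t).comp hgm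
  have hleft : ∀ t ∈ Icc s₀ s₁, ν t = ν₁ t := by
    intro t ht
    refine Subtype.ext ((hνγ t ⟨ht.1, ht.2.trans h₁₂⟩).trans (Eq.trans ?_ (hνγ₁ t ht).symm))
    congr 1
    funext p
    exact glueMotion_left h₀₁ h₁₂ p ht
  have hright : ∀ t ∈ Icc s₁ s₂, proj (ν t) = proj (ν₂ t) := by
    intro t ht
    refine Subtype.ext ((proj_eq_of_map_eq (hmg _)
      (hνγ t ⟨h₀₁.trans ht.1, ht.2⟩)).trans (Eq.trans ?_
      (proj_eq_of_map_eq (hm₂ _) (hνγ₂ t ht)).symm))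
    refine Measure.map_congr ?_
    filter_upwards [hγ] with p hp
    exact glueMotion_right_fst h₀₁ h₁₂ hp ht
  refine ⟨ν, ⟨χ, ?_, hνχ, ?_⟩, hleft, hright, fun ψ₁ ψ₂ => ?_⟩
  · rw [hχm]
    exact (HasFiniteFirstMoment.prod (by rwa [hγ₁]) (by rwa [hγ₂])).map hl
  · rw [hχm]
    refine ae_map_of_ae_comp _ hl.continuous ?_
    rw [← hγ₁] at hχS₁
    rw [← hγ₂] at hχS₂
    filter_upwards [hγ, ae_of_ae_map measurable_fst.aemeasurable hχS₁,
      ae_of_ae_map measurable_snd.aemeasurable hχS₂] with p hp h1 h2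
    refine glueMotion_mem_SOL h₀₁ h₁₂ ?_ ?_ hp
    · rwa [SOL_congr h₀₁ fun t ht => by rw [hleft t ht]]
    · rwa [SOL_congr h₁₂ hright]
  · have hi₁ : Integrable (fun p : Motions d s₀ s₁ × Motions d s₁ s₂ =>
        ψ₁ (p.1 ⟨s₁, hr₁⟩).1 + (p.1 ⟨s₁, hr₁⟩).2) (γ : Measure (Motions d s₀ s₁ × Motions d s₁ s₂)) := by
      have h := integrable_payoff hχ₁ ψ₁ ⟨s₁, hr₁⟩
      rw [← hγ₁] at h
      exact h.comp_measurable measurable_fst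
    have hi₂ : ∀ (ψ : C(Torus d, ℝ)) t, Integrable (fun p : Motions d s₀ s₁ × Motions d s₁ s₂ =>
        ψ (p.2 t).1 + (p.2 t).2) (γ : Measure (Motions d s₀ s₁ × Motions d s₁ s₂)) := by
      intro ψ t
      have h := integrable_payoff hχ₂ ψ t
      rw [← hγ₂] at h
      exact h.comp_measurable measurable_snd
    have hi₃ : Integrable (fun p : Motions d s₀ s₁ × Motions d s₁ s₂ =>
        ψ₂ (p.2 ⟨s₂, hr₂⟩).1 + (p.2 ⟨s₂, hr₂⟩).2 - (ψ₁ (p.2 ⟨s₁, hl₂⟩).1 + (p.2 ⟨s₁, hl₂⟩).2))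
        (γ : Measure (Motions d s₀ s₁ × Motions d s₁ s₂)) := (hi₂ ψ₂ _).sub (hi₂ ψ₁ _)
    have hs₂ : s₂ ∈ Icc s₀ s₂ := right_mem_Icc.2 (h₀₁.trans h₁₂)
    rw [bracket_eq_of_map_eq ψ₂ (hmg _) (hνγ s₂ hs₂),
      bracket_eq_of_map_eq ψ₁ (hm₁ _) (hνγ₁ s₁ hr₁), bracket_eq_of_map_eq ψ₂ (hm₂ _)
      (hνγ₂ s₂ hr₂), bracket_eq_of_map_eq ψ₁ (hm₂ _) (hνγ₂ s₁ hl₂),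
      -- Under the coupling the states at `s₁` agree almost surely, so the two `ψ₁` terms cancel and
      -- only the increment of the second `z` remains.
      ← integral_sub (hi₂ ψ₂ _) (hi₂ ψ₁ _), ← integral_add hi₁ hi₃]
    refine integral_congr_ae ?_
    filter_upwards [hγ] with p hp
    simp only [Function.comp_apply] at hp
    rw [glueMotion_right_fst h₀₁ h₁₂ hp hr₂, glueMotion_right h₀₁ h₁₂ p hr₂, Prod.snd_add,
      Prod.snd_sub, hp]
    ring

/-- In the payoff formula of `exists_concatenation`, the difference is nonnegative by the second
inequality, and the remaining term is bounded below by the first. -/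
theorem multiComp_subset_Psi [MetricSpace U] [CompactSpace U] {T : ℝ}
    (hfg : StandingAssumptions T f g) {s₀ s₁ s₂ : ℝ} (h₀ : 0 ≤ s₀) (h₀₁ : s₀ < s₁) (h₁₂ : s₁ < s₂)
    (h₂ : s₂ ≤ T) (p : ProbTorus d × C(Torus d, ℝ)) :
    multiComp (Psi f g h₁₂.le) (Psi f g h₀₁.le) p ⊆ Psi f g (h₀₁.trans h₁₂).le p := by
  intro q hq
  obtain ⟨⟨μ, ψ₁⟩, ⟨ν₁, hν₁, hp₁, hq₁, hφ₁, hb₁⟩, ν₂, hν₂, hp₂, hq₂, hφ₂, hb₂⟩ := mem_iUnion₂.1 hq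
  obtain ⟨ν, hν, hl, hr, hb⟩ := exists_concatenation h₀₁.le h₁₂.le hν₁ hν₂ (hq₁.trans hp₂.symm)
  have := nonempty_of_solvesMFDI (h₀₁.trans h₁₂) hν
  have hm := regularAlong_of_solvesMFDI hfg _ h₀ h₂ hν
  have hl' : ∀ t ∈ Icc s₀ s₁, proj (ν t) = proj (ν₁ t) := fun t ht => by rw [hl t ht]
  have hs₀ := left_mem_Icc.2 h₀₁.le
  refine ⟨ν, hν, (hl' s₀ hs₀).trans hp₁, (hr s₂ (right_mem_Icc.2 h₁₂.le)).trans hq₂, fun y => ?_, ?_⟩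
  · rw [bellman_comp h₀₁.le h₁₂.le hm ψ₁ q.2 fun y => by rw [bellman_congr h₁₂.le hr]; exact hφ₂ y,
      bellman_congr h₀₁.le hl']
    exact hφ₁ y
  · rw [hl s₀ hs₀, hb ψ₁ q.2]
    linarith

/-! ### The identity at coinciding times -/

theorem mem_SOL_self (s : ℝ) (m : ℝ → ProbTorus d) (w : Motions d s s) :
    w ∈ SOL f g (le_refl s) m := by
  refine ⟨0, 0, integrableOn_zero, integrableOn_zero, ?_, fun t ht => ?_⟩
  · filter_upwards [compl_mem_ae_iff.2 (measure_singleton s)] with t ht ht'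
    exact absurd (by simpa using ht') ht
  · obtain rfl : t = s := by simpa using ht
    simp [toTorus_zero]

theorem bellman_self (s : ℝ) (m : ℝ → ProbTorus d) (ψ : C(Torus d, ℝ)) (y : Torus d) :
    bellman f g (le_refl s) m ψ y = ψ y := by
  have : {c : ℝ | ∃ w ∈ Sol f g (le_refl s) y m, c = ψ (w ⟨s, right_mem_Icc.2 le_rfl⟩).1
      + (w ⟨s, right_mem_Icc.2 le_rfl⟩).2 - (w ⟨s, left_mem_Icc.2 le_rfl⟩).2} = {ψ y} := by
    refine eq_singleton_iff_unique_mem.2 ⟨⟨ContinuousMap.const _ (y, 0),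
      ⟨mem_SOL_self s m _, rfl⟩, by simp⟩, ?_⟩
    rintro _ ⟨w, hw, rfl⟩
    rw [hw.2, add_sub_cancel_right]
  rw [bellman, this, csSup_singleton]

theorem hasFiniteFirstMoment_of_compactSpace {X : Type*} [MetricSpace X] [MeasurableSpace X]
    [CompactSpace X] [Nonempty X] (μ : Measure X) [IsFiniteMeasure μ] :
    HasFiniteFirstMoment μ := by
  obtain ⟨x₀⟩ := ‹Nonempty X›
  refine ⟨x₀, ?_⟩
  calc _ ≤ ∫⁻ _, ENNReal.ofReal (Metric.diam (univ : Set X)) ∂μ := lintegral_mono fun x => by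
        rw [edist_dist]
        gcongr
        exact Metric.dist_le_diam_of_mem isCompact_univ.isBounded (mem_univ _) (mem_univ _)
    _ < ⊤ := by
      rw [lintegral_const]
      exact ENNReal.mul_lt_top ENNReal.ofReal_lt_top (measure_lt_top _ _)

theorem Psi_self (s : ℝ) (p : ProbTorus d × C(Torus d, ℝ)) : Psi f g (le_refl s) p = {p} := by
  refine eq_singleton_iff_unique_mem.2 ⟨?_, ?_⟩
  -- The witness is carried by the motions `(x, 0)`, with `x` distributed by `p.1`; over a single
  -- instant every motion is a solution.
  · have hR : LipschitzWith 1 fun x : Torus d =>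
        (ContinuousMap.const (Icc s s) (x, (0 : ℝ)) : Motions d s s) := by
      refine LipschitzWith.of_dist_le_mul fun x y => ?_
      rw [ContinuousMap.dist_le (by positivity)]
      intro t
      simp [Prod.dist_eq]
    have hj : Measurable fun x : Torus d => (x, (0 : ℝ)) := by fun_prop
    refine ⟨fun _ => p.1.map hj.aemeasurable, ⟨p.1.map hR.continuous.measurable.aemeasurable,
      (hasFiniteFirstMoment_of_compactSpace _).map hR, fun t ht => ?_, ae_of_all _ fun w =>
      mem_SOL_self s _ w⟩, ?_, ?_, fun y => (bellman_self s _ _ _).symm, le_rfl⟩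
    · rw [ProbabilityMeasure.toMeasure_map, ProbabilityMeasure.toMeasure_map,
        Measure.map_map (measurable_eval _) hR.continuous.measurable]
      rfl
    all_goals
      refine Subtype.ext ((proj_eq_of_map_eq hj rfl).trans ?_)
      exact Measure.map_id
  · rintro ⟨μ, ψ⟩ ⟨ν, -, hp, hq, hφ, -⟩
    refine Prod.ext (hq.symm.trans hp) (ContinuousMap.ext fun y => ?_)
    rw [hφ y, bellman_self]

end Flows

end MFG
end

theorem mainTheorem4 {d : ℕ} {U : Type*} [MetricSpace U] [CompactSpace U] (T : ℝ)
    (f : ℝ → MFG.Torus d → MFG.ProbTorus d → U → EuclideanSpace ℝ (Fin d))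
    (g : ℝ → MFG.Torus d → MFG.ProbTorus d → U → ℝ)
    (hfg : MFG.StandingAssumptions T f g) :
    (∀ s ∈ Set.Icc (0 : ℝ) T, ∀ p : MFG.ProbTorus d × C(MFG.Torus d, ℝ),
      MFG.Psi f g (le_refl s) p = {p}) ∧
    ∀ s₀ ∈ Set.Icc (0 : ℝ) T, ∀ s₁ ∈ Set.Icc (0 : ℝ) T, ∀ s₂ ∈ Set.Icc (0 : ℝ) T,
      ∀ (h₀₁ : s₀ < s₁) (h₁₂ : s₁ < s₂),
        MFG.Psi f g (h₀₁.trans h₁₂).le =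
          MFG.multiComp (MFG.Psi f g h₁₂.le) (MFG.Psi f g h₀₁.le) :=
  ⟨fun s _ p => MFG.Psi_self s p, fun _ h₀ _ _ _ h₂ h₀₁ h₁₂ => funext fun p =>
    (MFG.Psi_subset_multiComp hfg h₀.1 h₀₁ h₁₂ h₂.2 p).antisymm
      (MFG.multiComp_subset_Psi hfg h₀.1 h₀₁ h₁₂ h₂.2 p)⟩
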